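/- **Setting.** Let $\zeta=+1$ (bosons) or $\zeta=-1$ (fermions) and $[X,Y]_\zeta=XY-\zeta YX$. There are $R$ reservoirs of noninteracting particles, with ladder operators obeying the canonical $\zeta$-commutation relations, commuting quadratic number-conserving Hamiltonians $H_\alpha$, number operators $N_\alpha$, chemical potentials $\mu_\alpha$ and $\Omega_\alpha=H_\alpha-\mu_\alpha N_\alpha$. The initial environment state $\omega_E$ commutes with every $\Omega_\alpha$. The coupling to the system is $\sum_\mu A_\mu\otimes B_\mu$, with $\mu=(\alpha,i)$, $i\in\{0,1\}$, $B_{(\alpha,0)}=B_\alpha^\dagger$, $B_{(\alpha,1)}=B_\alpha$, $A_{(\alpha,0)}=A_\alpha$, $A_{(\alpha,1)}=A_\alpha^\dagger$; here $B_\alpha$ is linear in the annihilation operators of reservoir $\alpha$ and $A_\alpha$ is linear in the ladder operators of the system, whose Hamiltonian $H_S$ is quadratic, so that $[A_\mu(s),A_\nu(r)]_\zeta$ is a number. $A_\mu(s)$ and $B_\mu(s)$ evolve under $H_S$ and $\sum_\alpha H_\alpha$. The correlations $\operatorname{Tr}[B_\mu(s)B_\nu(r)\omega_E]$ are assumed to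 be $C^1$ in $(s,r)$ and the numbers $[A_\mu(s),A_\nu(0)]_\zeta$ to be continuous in $s$. Fix $t\ge 0$. The Keldysh contour $\gamma(t)$ runs along the branch $\gamma_+$ from $t$ to $0$ and then along $\gamma_-$ from $0$ to $t$; thus $\int_{\gamma(t)}dz\,f(z)=\int_0^t f(\tau_-)\,d\tau-\int_0^t f(\tau_+)\,d\tau$. Write $z\prec w$ if $z$ precedes $w$ on $\gamma(t)$. For $\boldsymbol\lambda\in\mathbb R^R$ let $u_{\boldsymbol\lambda}=e^{-i\sum_\alpha\Omega_\alpha\lambda_\alpha/2}$, $\tilde B_\mu(z_\pm;\boldsymbol\lambda)=u_{\mp\boldsymbol\lambda}B_\mu(z)u_{\mp\boldsymbol\lambda}^\dagger$ and $$\tilde C_{\mu\nu}(z,w;\boldsymbol\lambda)=\operatorname{Tr}\mathbb T_\zeta[\tilde B_\mu(z;\boldsymbol\lambda)\tilde B_\nu(w;\boldsymbol\lambda)\,\omega_E],\qquad C=\tilde C|_{\boldsymbol\lambda=\mathbf 0},$$ where $\mathbb T_\zeta$ is contour ordering, with a factor $\zeta$ per exchange (and $\theta(0)=\tfrac12$).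 Operators on $\gamma_-$ stand to the left of $\omega_E$, operators on $\gamma_+$ to its right; thus for $z\in\gamma_+$, $w\in\gamma_-$ the value is $\operatorname{Tr}[\tilde B_\mu(z;\boldsymbol\lambda)\tilde B_\nu(w;\boldsymbol\lambda)\omega_E]$, and for $z\in\gamma_-$, $w\in\gamma_+$ it is $\zeta\operatorname{Tr}[\tilde B_\nu(w;\boldsymbol\lambda)\tilde B_\mu(z;\boldsymbol\lambda)\omega_E]$. The self-energy is $\Sigma_{\mu\nu}(z,w)=\theta_{z\prec w}[A_\mu(z),A_\nu(w)]_\zeta$ for $z\in\gamma_-$ and $-\theta_{z\succ w}[A_\mu(z),A_\nu(w)]_\zeta$ for $z\in\gamma_+$. A tilted dressed Green's function $\tilde G(\cdot,\cdot;\boldsymbol\lambda)$ is a solution, measurable and bounded in its second argument, of $$\tilde G(12)=\tilde C(12)+\iint_{\gamma(t)}d(34)\,\tilde G(13)\,\Sigma(34)\,\tilde C(42).$$ Assume that for $\boldsymbol\lambda=\mathbf 0$ this Dyson equation has exactly one solution $G$, the untilted dressed Green's function. **Claim.** For all $\boldsymbol\lambda$ near $\mathbf 0$ the equation has exactly one solution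 $\tilde G$, and for every $\alpha$ the bare and dressed heat kernels $$c_\alpha=i\,\partial_{\lambda_\alpha}\tilde C\big|_{\boldsymbol\lambda=\mathbf 0},\qquad g_\alpha=i\,\partial_{\lambda_\alpha}\tilde G\big|_{\boldsymbol\lambda=\mathbf 0}$$ exist (pointwise derivatives), and are measurable and bounded in the second argument. They satisfy the following. 1. On the contour, $$g_\alpha(12)=c_\alpha(12)+\iint_{\gamma(t)}d(34)\,\{G(13)\Sigma(34)c_\alpha(42)+g_\alpha(13)\Sigma(34)C(42)\}.$$ 2. Write $F^>(x,y)=F(x_+,y_-)$, $F^<(x,y)=F(x_-,y_+)$, $F^{\mathbb T}(x,y)=F(x_-,y_-)$, $F^{\tilde{\mathbb T}}(x,y)=F(x_+,y_+)$ for $x,y\in[0,t]$, and $$[K^Xf](12)=\iint_{[0,t]}d(34)\,G^X(13)\Sigma^{\mathbb T}(34)f(42),\qquad [I^Yf](12)=\iint_{[0,t]}d(34)\,f(13)\Sigma^{\mathbb T}(34)C^Y(42).$$ Then for all times in $[0,t]$ $$g^>_\alpha=c^>_\alpha-K^{\tilde{\mathbb T}}c^>_\alpha+I^{\mathbb T}g^>_\alpha-I^>g^{\tilde{\mathbb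 T}}_\alpha,\qquad g^{\tilde{\mathbb T}}_\alpha=K^>c^<_\alpha+I^<g^>_\alpha-I^{\tilde{\mathbb T}}g^{\tilde{\mathbb T}}_\alpha .$$ At first argument $t$ (the endpoint of the contour), where the heat current is evaluated, $K^{\tilde{\mathbb T}}c^>_\alpha$ may be replaced by $K^<c^>_\alpha$: for every $\tau\in[0,t]$, at $(t,\tau)$, $$g^>_\alpha=c^>_\alpha-K^{<}c^>_\alpha+I^{\mathbb T}g^>_\alpha-I^>g^{\tilde{\mathbb T}}_\alpha .$$ 3. The other two components are the effective conjugates ${}^\bigstar f=\zeta(\mathbb 1_R\otimes\sigma_x)f^*(\mathbb 1_R\otimes\sigma_x)$, with $f^*$ the entrywise complex conjugate: for all times in $[0,t]$, $g^<_\alpha={}^\bigstar g^>_\alpha$ and $g^{\mathbb T}_\alpha={}^\bigstar g^{\tilde{\mathbb T}}_\alpha$. -/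

import Mathlib

open scoped Matrix Kronecker ComplexConjugate Topology

noncomputable section

namespace Keldysh

/-! ### Particle statistics and ladder operators -/

/-- The common quantum statistics of all the particles. -/
inductive Statistics
  | boson
  | fermion

/-- `ζ = +1` for bosons, `ζ = -1` for fermions. -/
def Statistics.sign : Statistics → ℂ
  | .boson => 1
  | .fermion => -1

/-- `[X, Y]_ζ = X Y - ζ Y X`: the commutator for bosons, the anticommutator for fermions. -/
def zetaComm (ζ : Statistics) {𝔄 : Type*} [Ring 𝔄] [Algebra ℂ 𝔄] (X Y : 𝔄) : 𝔄 :=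
  X * Y - ζ.sign • (Y * X)

/-- The index `μ = (α, i)`: each reservoir `α` carries two coupling operators,
`i = 0` for `B_α†` and `i = 1` for `B_α`. -/
abbrev Idx (R : ℕ) := Fin R × Fin 2

/-- `R` reservoirs of noninteracting particles in the initial state `ω_E`, together with their
coupling operators. `𝔥 α` is the one-particle space of reservoir `α` and `𝔄` is a `*`-algebra of
environment observables which contains the ladder operators (for density operators,
`expect X = Tr[X ω_E]`). -/
structure Environment (ζ : Statistics) (R : ℕ) (𝔥 : Fin R → Type*)
    [∀ α, NormedAddCommGroup (𝔥 α)] [∀ α, InnerProductSpace ℂ (𝔥 α)]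
    (𝔄 : Type*) [Ring 𝔄] [StarRing 𝔄] [Algebra ℂ 𝔄] [StarModule ℂ 𝔄] where
  /-- annihilation operators `c_α(f)`; the creation operators are their adjoints -/
  annih : ∀ α, 𝔥 α →ₗ⋆[ℂ] 𝔄
  annih_annih : ∀ α β f g, zetaComm ζ (annih α f) (annih β g) = 0
  annih_create : ∀ α f g,
    zetaComm ζ (annih α f) (star (annih α g)) = algebraMap ℂ 𝔄 (inner ℂ f g)
  annih_create_ne : ∀ α β, α ≠ β → ∀ f g, zetaComm ζ (annih α f) (star (annih β g)) = 0
  /-- one-particle evolution `e^{i h_α s}` -/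
  oneParticle : ∀ α, ℝ → (𝔥 α ≃ₗᵢ[ℂ] 𝔥 α)
  oneParticle_add : ∀ α s r f, oneParticle α (s + r) f = oneParticle α s (oneParticle α r f)
  oneParticle_continuous : ∀ α f, Continuous fun s => oneParticle α s f
  /-- `X ↦ e^{i ∑ H_α s_α} X e^{-i ∑ H_α s_α}`, where `H_α` is the quadratic, number-conserving
  Hamiltonian of reservoir `α` -/
  energyFlow : (Fin R → ℝ) → (𝔄 ≃⋆ₐ[ℂ] 𝔄)
  energyFlow_add : ∀ s r X, energyFlow (s + r) X = energyFlow s (energyFlow r X)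
  energyFlow_annih : ∀ s α f, energyFlow s (annih α f) = annih α (oneParticle α (s α) f)
  /-- `X ↦ e^{i ∑ N_α s_α} X e^{-i ∑ N_α s_α}`, where `N_α` is the number operator of
  reservoir `α` -/
  numberFlow : (Fin R → ℝ) → (𝔄 ≃⋆ₐ[ℂ] 𝔄)
  numberFlow_add : ∀ s r X, numberFlow (s + r) X = numberFlow s (numberFlow r X)
  numberFlow_annih : ∀ s α f,
    numberFlow s (annih α f) = Complex.exp (-(Complex.I * s α)) • annih α f
  /-- `[H_α, N_β] = 0` -/
  flow_comm : ∀ s r X, energyFlow s (numberFlow r X) = numberFlow r (energyFlow s X)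
  /-- chemical potentials -/
  chem : Fin R → ℝ
  /-- expectation in the initial state `ω_E` -/
  expect : 𝔄 →ₗ[ℂ] ℂ
  expect_one : expect 1 = 1
  expect_star : ∀ X, expect (star X) = conj (expect X)
  expect_nonneg : ∀ X, 0 ≤ (expect (star X * X)).re
  /-- `ω_E` commutes with every grand-canonical Hamiltonian `Ω_α = H_α - μ_α N_α` -/
  expect_grand : ∀ (s : Fin R → ℝ) X,
    expect (energyFlow s (numberFlow (fun α => -(chem α * s α)) X)) = expect X
  /-- one-particle vectors with `B_α = c_α(φ_α)` -/
  formFactor : ∀ α, 𝔥 α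

namespace Environment

variable {ζ : Statistics} {R : ℕ} {𝔥 : Fin R → Type*}
  [∀ α, NormedAddCommGroup (𝔥 α)] [∀ α, InnerProductSpace ℂ (𝔥 α)]
  {𝔄 : Type*} [Ring 𝔄] [StarRing 𝔄] [Algebra ℂ 𝔄] [StarModule ℂ 𝔄]

/-- The coupling operators: `B_{(α,0)} = B_α†` and `B_{(α,1)} = B_α`. -/
def couplingOp (E : Environment ζ R 𝔥 𝔄) (μ : Idx R) : 𝔄 :=
  if μ.2 = 0 then star (E.annih μ.1 (E.formFactor μ.1)) else E.annih μ.1 (E.formFactor μ.1)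

/-- Interaction picture: `B_μ(s) = e^{i H_E s} B_μ e^{-i H_E s}` with `H_E = ∑ H_α`. -/
def op (E : Environment ζ R 𝔥 𝔄) (μ : Idx R) (s : ℝ) : 𝔄 :=
  E.energyFlow (fun _ => s) (E.couplingOp μ)

/-- `X ↦ e^{i ∑ Ω_α s_α} X e^{-i ∑ Ω_α s_α}` with `Ω_α = H_α - μ_α N_α`. -/
def grandFlow (E : Environment ζ R 𝔥 𝔄) (s : Fin R → ℝ) (X : 𝔄) : 𝔄 :=
  E.energyFlow s (E.numberFlow (fun α => -(E.chem α * s α)) X)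

/-- The physical-time correlation function `Tr[B_μ(s) B_ν(r) ω_E]`. -/
def correlation (E : Environment ζ R 𝔥 𝔄) (μ ν : Idx R) (s r : ℝ) : ℂ :=
  E.expect (E.op μ s * E.op ν r)

end Environment

/-- A system of noninteracting particles with quadratic Hamiltonian `H_S` (possibly with anomalous
terms) and coupling operators linear in its ladder operators. `𝔨` is the one-particle space and
`𝔖` is a `*`-algebra of system observables. -/
structure System (ζ : Statistics) (R : ℕ) (𝔨 : Type*)
    [NormedAddCommGroup 𝔨] [InnerProductSpace ℂ 𝔨]
    (𝔖 : Type*) [Ring 𝔖] [StarRing 𝔖] [Algebra ℂ 𝔖] [StarModule ℂ 𝔖] where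
  /-- annihilation operators `a(f)` -/
  annih : 𝔨 →ₗ⋆[ℂ] 𝔖
  annih_annih : ∀ f g, zetaComm ζ (annih f) (annih g) = 0
  annih_create : ∀ f g, zetaComm ζ (annih f) (star (annih g)) = algebraMap ℂ 𝔖 (inner ℂ f g)
  /-- `X ↦ e^{i H_S s} X e^{-i H_S s}` -/
  flow : ℝ → (𝔖 ≃⋆ₐ[ℂ] 𝔖)
  flow_add : ∀ s r X, flow (s + r) X = flow s (flow r X)
  /-- `H_S` is quadratic: ladder operators evolve linearly -/
  flow_annih : ∀ s f, ∃ g h, flow s (annih f) = annih g + star (annih h)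
  /-- the operators `A_α`, which are coupled to `B_α†` -/
  coupling : Fin R → 𝔖
  coupling_linear : ∀ α, ∃ g h, coupling α = annih g + star (annih h)

namespace System

variable {ζ : Statistics} {R : ℕ} {𝔨 : Type*}
  [NormedAddCommGroup 𝔨] [InnerProductSpace ℂ 𝔨]
  {𝔖 : Type*} [Ring 𝔖] [StarRing 𝔖] [Algebra ℂ 𝔖] [StarModule ℂ 𝔖]

/-- The system operator coupled to `B_μ`: `A_{(α,0)} = A_α` and `A_{(α,1)} = A_α†`. -/
def couplingOp (S : System ζ R 𝔨 𝔖) (μ : Idx R) : 𝔖 :=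
  if μ.2 = 0 then S.coupling μ.1 else star (S.coupling μ.1)

/-- Interaction picture: `A_μ(s)`. -/
def op (S : System ζ R 𝔨 𝔖) (μ : Idx R) (s : ℝ) : 𝔖 := S.flow s (S.couplingOp μ)

theorem op_linear (S : System ζ R 𝔨 𝔖) (μ : Idx R) (s : ℝ) :
    ∃ g h, S.op μ s = S.annih g + star (S.annih h) := by
  have key : ∀ g h, ∃ g' h',
      S.flow s (S.annih g + star (S.annih h)) = S.annih g' + star (S.annih h') := by
    intro g h
    obtain ⟨g₁, h₁, e₁⟩ := S.flow_annih s g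
    obtain ⟨g₂, h₂, e₂⟩ := S.flow_annih s h
    refine ⟨g₁ + h₂, h₁ + g₂, ?_⟩
    rw [map_add, map_star, e₁, e₂]
    simp only [star_add, star_star, map_add]
    abel
  obtain ⟨g, h, e⟩ := S.coupling_linear μ.1
  unfold op couplingOp
  split_ifs
  · rw [e]; exact key g h
  · rw [e, star_add, star_star, add_comm]; exact key h g

/-- `[A_μ(s), A_ν(r)]_ζ` is a c-number. -/
theorem exists_commutator (S : System ζ R 𝔨 𝔖) (μ ν : Idx R) (s r : ℝ) :
    ∃ k : ℂ, zetaComm ζ (S.op μ s) (S.op ν r) = algebraMap ℂ 𝔖 k := by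
  obtain ⟨g, h, e⟩ := S.op_linear μ s
  obtain ⟨g', h', e'⟩ := S.op_linear ν r
  have hζ : ζ.sign * ζ.sign = 1 := by cases ζ <;> simp [Statistics.sign]
  have hflip : ∀ X Y : 𝔖, zetaComm ζ X Y = -(ζ.sign • zetaComm ζ Y X) := by
    intro X Y
    simp only [zetaComm, smul_sub, smul_smul, hζ, one_smul]
    abel
  have hadd : zetaComm ζ (S.annih g + star (S.annih h)) (S.annih g' + star (S.annih h'))
      = zetaComm ζ (S.annih g) (S.annih g') + zetaComm ζ (S.annih g) (star (S.annih h'))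
        + zetaComm ζ (star (S.annih h)) (S.annih g')
        + zetaComm ζ (star (S.annih h)) (star (S.annih h')) := by
    simp only [zetaComm, add_mul, mul_add, smul_add]
    abel
  have hstar : zetaComm ζ (star (S.annih h)) (star (S.annih h')) = 0 := by
    have := congrArg star (S.annih_annih h' h)
    have hs : star ζ.sign = ζ.sign := by cases ζ <;> simp [Statistics.sign]
    simpa [zetaComm, hs] using this
  refine ⟨inner ℂ g h' - ζ.sign * inner ℂ g' h, ?_⟩
  rw [e, e', hadd, S.annih_annih, S.annih_create, hstar, hflip (star (S.annih h)),
    S.annih_create, map_sub, map_mul, Algebra.smul_def]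
  abel

/-- The c-number `[A_μ(s), A_ν(r)]_ζ`. -/
def commutator (S : System ζ R 𝔨 𝔖) (μ ν : Idx R) (s r : ℝ) : ℂ :=
  (S.exists_commutator μ ν s r).choose

end System

/-! ### The Keldysh contour -/

/-- The backward branch is `γ_+`, the forward branch is `γ_-`. -/
inductive Branch
  | backward
  | forward

/-- The contour `γ(t)`: first `γ_+` from `t` to `0`, then `γ_-` from `0` to `t`. -/
abbrev Contour (t : ℝ) := Branch × Set.Icc (0 : ℝ) t

/-- `z ≺ w`: the point `z` comes before `w` along the contour. -/
def Contour.precedes {t : ℝ} : Contour t → Contour t → Prop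
  | (.backward, _), (.forward, _) => True
  | (.forward, _), (.backward, _) => False
  | (.forward, x), (.forward, y) => x < y
  | (.backward, x), (.backward, y) => y < x

open Classical in
/-- `θ_{z ≻ w}`, with the value `1/2` at coinciding points. -/
def contourStep {t : ℝ} (z w : Contour t) : ℂ :=
  if Contour.precedes w z then 1 else if z = w then 1 / 2 else 0

/-- Matrix-valued functions of two contour arguments. -/
abbrev Kernel (R : ℕ) (t : ℝ) := Contour t → Contour t → Matrix (Idx R) (Idx R) ℂ

/-- Matrix-valued functions of two physical times in `[0, t]`. -/
abbrev TimeKernel (R : ℕ) (t : ℝ) :=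
  Set.Icc (0 : ℝ) t → Set.Icc (0 : ℝ) t → Matrix (Idx R) (Idx R) ℂ

/-- Lebesgue measure on `[0, t]`. -/
def timeMeasure (t : ℝ) : MeasureTheory.Measure (Set.Icc (0 : ℝ) t) :=
  MeasureTheory.Measure.comap Subtype.val MeasureTheory.volume

/-- Entrywise `∫_{γ(t)} dz f(z) = ∫_0^t f(τ_-) dτ - ∫_0^t f(τ_+) dτ`. -/
def contourIntegral {R : ℕ} {t : ℝ} (f : Contour t → Matrix (Idx R) (Idx R) ℂ) :
    Matrix (Idx R) (Idx R) ℂ :=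
  Matrix.of fun μ ν => (∫ τ, f (.forward, τ) μ ν ∂timeMeasure t) -
    ∫ τ, f (.backward, τ) μ ν ∂timeMeasure t

/-- Entrywise integral over `[0, t]`. -/
def timeIntegral {R : ℕ} {t : ℝ} (f : Set.Icc (0 : ℝ) t → Matrix (Idx R) (Idx R) ℂ) :
    Matrix (Idx R) (Idx R) ℂ :=
  Matrix.of fun μ ν => ∫ τ, f τ μ ν ∂timeMeasure t

/-- `F^>(x, y) = F(x_+, y_-)` -/
def Kernel.greater {R : ℕ} {t : ℝ} (F : Kernel R t) : TimeKernel R t :=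
  fun x y => F (.backward, x) (.forward, y)

/-- `F^<(x, y) = F(x_-, y_+)` -/
def Kernel.lesser {R : ℕ} {t : ℝ} (F : Kernel R t) : TimeKernel R t :=
  fun x y => F (.forward, x) (.backward, y)

/-- The time-ordered component `F(x_-, y_-)`. -/
def Kernel.timeOrd {R : ℕ} {t : ℝ} (F : Kernel R t) : TimeKernel R t :=
  fun x y => F (.forward, x) (.forward, y)

/-- The anti-time-ordered component `F(x_+, y_+)`. -/
def Kernel.antiOrd {R : ℕ} {t : ℝ} (F : Kernel R t) : TimeKernel R t :=
  fun x y => F (.backward, x) (.backward, y)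

/-- For each first argument, the kernel is a bounded measurable function of the second one. -/
def Kernel.IsRegular {R : ℕ} {t : ℝ} (F : Kernel R t) : Prop :=
  (∀ z b μ ν, Measurable fun y => F z (b, y) μ ν) ∧
    ∀ z, ∃ M : ℝ, ∀ w μ ν, ‖F z w μ ν‖ ≤ M

/-! ### Bare and dressed Green's functions -/

section Green

variable {ζ : Statistics} {R : ℕ} {𝔥 : Fin R → Type*}
  [∀ α, NormedAddCommGroup (𝔥 α)] [∀ α, InnerProductSpace ℂ (𝔥 α)]
  {𝔄 : Type*} [Ring 𝔄] [StarRing 𝔄] [Algebra ℂ 𝔄] [StarModule ℂ 𝔄]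

/-- `Tr T_ζ[X(z) Y(w) ω_E]`. Operators on `γ_-` act to the left of the initial state and operators
on `γ_+` to its right, so that by cyclicity of the trace `Tr[Y(w_-) ω_E X(z_+)] = Tr[X Y ω_E]`. -/
def contourOrdered (E : Environment ζ R 𝔥 𝔄) {t : ℝ} (X Y : 𝔄) (z w : Contour t) : ℂ :=
  match z.1, w.1 with
  | .backward, .forward => E.expect (X * Y)
  | .forward, .backward => ζ.sign * E.expect (Y * X)
  | .forward, .forward =>
      contourStep z w * E.expect (X * Y) + ζ.sign * contourStep w z * E.expect (Y * X)
  | .backward, .backward =>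
      contourStep z w * E.expect (X * Y) + ζ.sign * contourStep w z * E.expect (Y * X)

/-- The bare Green's function `C_{μν}(z, w) = Tr T_ζ[B_μ(z) B_ν(w) ω_E]`. -/
def bareGF (E : Environment ζ R 𝔥 𝔄) (t : ℝ) : Kernel R t :=
  fun z w => Matrix.of fun μ ν => contourOrdered E (E.op μ z.2) (E.op ν w.2) z w

/-- `B̃_μ(z_±; λ) = u_{∓λ} B_μ(z) u_{∓λ}†` with `u_λ = e^{-i ∑ Ω_α λ_α / 2}`. -/
def tiltedOp (E : Environment ζ R 𝔥 𝔄) {t : ℝ} (lam : Fin R → ℝ) (μ : Idx R) (z : Contour t) :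
    𝔄 :=
  match z.1 with
  | .backward => E.grandFlow (fun α => lam α / 2) (E.op μ z.2)
  | .forward => E.grandFlow (fun α => -(lam α / 2)) (E.op μ z.2)

/-- The tilted Green's function `C̃_{μν}(z, w; λ) = Tr T_ζ[B̃_μ(z; λ) B̃_ν(w; λ) ω_E]`. -/
def tiltedGF (E : Environment ζ R 𝔥 𝔄) (t : ℝ) (lam : Fin R → ℝ) : Kernel R t :=
  fun z w => Matrix.of fun μ ν => contourOrdered E (tiltedOp E lam μ z) (tiltedOp E lam ν w) z w

/-- The self-energy: `θ_{z ≺ w} [A_μ(z), A_ν(w)]_ζ` for `z ∈ γ_-` and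
`-θ_{z ≻ w} [A_μ(z), A_ν(w)]_ζ` for `z ∈ γ_+`. -/
def selfEnergy {𝔨 : Type*} [NormedAddCommGroup 𝔨] [InnerProductSpace ℂ 𝔨]
    {𝔖 : Type*} [Ring 𝔖] [StarRing 𝔖] [Algebra ℂ 𝔖] [StarModule ℂ 𝔖]
    (S : System ζ R 𝔨 𝔖) (t : ℝ) : Kernel R t :=
  fun z w => Matrix.of fun μ ν =>
    match z.1 with
    | .forward => contourStep w z * S.commutator μ ν z.2 w.2
    | .backward => -contourStep z w * S.commutator μ ν z.2 w.2

end Green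

/-- `G` solves the Dyson equation `G(12) = C(12) + ∬_{γ(t)} d(34) G(13) Σ(34) C(42)`. -/
def IsDressed {R : ℕ} {t : ℝ} (C Sig G : Kernel R t) : Prop :=
  G.IsRegular ∧ ∀ z w, G z w = C z w +
    contourIntegral fun x => contourIntegral fun y => G z x * Sig x y * C y w

/-- `i ∂F(z, w; λ)/∂λ_α` at `λ = 0`, entrywise. -/
def heatKernel {R : ℕ} {t : ℝ} (F : (Fin R → ℝ) → Kernel R t) (α : Fin R) : Kernel R t :=
  fun z w => Matrix.of fun μ ν =>
    Complex.I * deriv (fun x : ℝ => F (Pi.single α x) z w μ ν) 0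

/-- `[K^X f](12) = ∬_{[0,t]} d(34) G^X(13) Σ^T(34) f(42)`, from `G^X` and `Σ^T`. -/
def functionalK {R : ℕ} {t : ℝ} (GX SigT f : TimeKernel R t) : TimeKernel R t :=
  fun x y => timeIntegral fun u => timeIntegral fun v => GX x u * SigT u v * f v y

/-- `[I^Y f](12) = ∬_{[0,t]} d(34) f(13) Σ^T(34) C^Y(42)`, from `C^Y` and `Σ^T`. -/
def functionalI {R : ℕ} {t : ℝ} (CY SigT f : TimeKernel R t) : TimeKernel R t :=
  fun x y => timeIntegral fun u => timeIntegral fun v => f x u * SigT u v * CY v y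

/-- The effective conjugate `ζ (1_R ⊗ σ_x) F^* (1_R ⊗ σ_x)`. -/
def effConj {R : ℕ} (ζ : Statistics) (F : Matrix (Idx R) (Idx R) ℂ) : Matrix (Idx R) (Idx R) ℂ :=
  ζ.sign • (((1 : Matrix (Fin R) (Fin R) ℂ) ⊗ₖ !![0, 1; 1, 0]) * F.map conj *
    ((1 : Matrix (Fin R) (Fin R) ℂ) ⊗ₖ !![0, 1; 1, 0]))

end Keldysh

end

open Keldysh

/-!
The rows of the matrix-valued Dyson equation are scalar Fredholm integral equations on the space
`IndexedContour R t` of contour points together with a matrix index: for fixed first argument `z`,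
`G(z, ·) = C(z, ·) + G(z, ·) S C`, where `S` is the self-energy, with the orientations of the
branches absorbed into it (`isDressed_iff`). The kernel `C` jumps at coinciding times only, so
`k ↦ k S C` maps bounded measurable functions to continuous ones and is a compact operator on
continuous functions (`IsFredholmKernel.isCompactOperator_op`). Uniqueness of the untilted solution
`G` says that `1 - (· S C)` is injective (`eq_zero_of_op_eq`); by the Fredholm alternative it is
invertible (`isUnit_one_sub_op`).

On coupling operators the flow generated by the `Ω_α` is a time shift up to a phase
(`Environment.grandFlow_op`), and the initial state is invariant under it. Hence the tilt does not
change the components of `C̃` on a single branch, while the components between the branches are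
shifted `C¹` correlation functions (`tiltedGF_scalar`). So `C̃ = C + Δ_λ` with a continuous kernel
`Δ_λ`, which depends continuously on `λ` in the supremum norm and is differentiable at `λ = 0`
along each axis (`hasDerivAt_tiltFamily`). The tilted solutions are `G + k` with `k` continuous and
`(1 - (· S C) - (· S Δ_λ)) k = Δ_λ(z, ·) + G(z, ·) S Δ_λ` (`DysonKernels.solvesRow_iff`). For small
`λ` the operator on the left is invertible, which gives existence and uniqueness, and
differentiating the solution at `λ = 0` gives the linearized Dyson equation
(`DysonKernels.hasDerivAt_correction`, `heatKernel_dressed_eq`).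

The equations in physical time are the branch components of the linearized equation: the self-energy
is diagonal in the branches and odd under their exchange, and the bare heat kernel vanishes on a
single branch. At the endpoint `t` the rows of `C` at `t_+` and `t_-` agree almost everywhere, hence
so do those of `G`, by injectivity (`dressed_endpoint`). Finally, effective conjugation combined
with the exchange of the branches fixes the self-energy and maps the tilt `λ` to `-λ`, so by
uniqueness it maps `G̃(λ)` to `G̃(-λ)`; the factor `i` in the heat kernels compensates the sign of
the derivative (`heatKernel_dressed_star`).
-/

noncomputable section

namespace Keldysh

open MeasureTheory Filter

/-! ### Bounded measurable functions -/

/-- Bounded measurable complex functions. -/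
def IsBddMeas {Y : Type*} [MeasurableSpace Y] (h : Y → ℂ) : Prop :=
  Measurable h ∧ ∃ M : ℝ, ∀ x, ‖h x‖ ≤ M

section BddMeas

variable {Y : Type*} [MeasurableSpace Y] {h k : Y → ℂ}

theorem IsBddMeas.integrable (hh : IsBddMeas h) (m : Measure Y) [IsFiniteMeasure m] :
    Integrable h m := by
  obtain ⟨hm, M, hM⟩ := hh
  exact Integrable.of_bound hm.aestronglyMeasurable M (Eventually.of_forall hM)

theorem IsBddMeas.mul (hh : IsBddMeas h) (hk : IsBddMeas k) : IsBddMeas fun x => h x * k x := by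
  obtain ⟨hm, M, hM⟩ := hh
  obtain ⟨km, N, hN⟩ := hk
  refine ⟨hm.mul km, M * N, fun x => ?_⟩
  rw [norm_mul]
  exact mul_le_mul (hM x) (hN x) (norm_nonneg _) ((norm_nonneg _).trans (hM x))

theorem IsBddMeas.add (hh : IsBddMeas h) (hk : IsBddMeas k) : IsBddMeas fun x => h x + k x := by
  obtain ⟨hm, M, hM⟩ := hh
  obtain ⟨km, N, hN⟩ := hk
  exact ⟨hm.add km, M + N, fun x => (norm_add_le _ _).trans (add_le_add (hM x) (hN x))⟩

theorem IsBddMeas.sub (hh : IsBddMeas h) (hk : IsBddMeas k) : IsBddMeas fun x => h x - k x := by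
  obtain ⟨hm, M, hM⟩ := hh
  obtain ⟨km, N, hN⟩ := hk
  exact ⟨hm.sub km, M + N, fun x => (norm_sub_le _ _).trans (add_le_add (hM x) (hN x))⟩

theorem isBddMeas_const (a : ℂ) : IsBddMeas fun _ : Y => a :=
  ⟨measurable_const, ‖a‖, fun _ => le_rfl⟩

theorem isBddMeas_of_continuous [TopologicalSpace Y] [CompactSpace Y] [OpensMeasurableSpace Y]
    (k : C(Y, ℂ)) : IsBddMeas k :=
  ⟨k.continuous.measurable, ‖k‖, k.norm_coe_le_norm⟩

end BddMeas

/-! ### Fredholm integral operators with almost everywhere continuous kernels -/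

/-- A bounded kernel, measurable in its first variable, such that near each value of the second
variable it is continuous in that variable for almost every value of the first one. Contour-ordered
correlation functions, which jump at coinciding times, are of this kind. -/
structure IsFredholmKernel {Y : Type*} [TopologicalSpace Y] [MeasurableSpace Y] (m : Measure Y)
    (P : Y → Y → ℂ) : Prop where
  measurable : ∀ w, Measurable fun x => P x w
  bounded : ∃ M : ℝ, ∀ x w, ‖P x w‖ ≤ M
  ae_continuousAt : ∀ w, ∀ᵐ x ∂m, ContinuousAt (P x) w

theorem IsFredholmKernel.isBddMeas {Y : Type*} [TopologicalSpace Y] [MeasurableSpace Y]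
    {m : Measure Y} {P : Y → Y → ℂ} (hP : IsFredholmKernel m P) (w : Y) :
    IsBddMeas fun x => P x w :=
  ⟨hP.measurable w, hP.bounded.imp fun _ h x => h x w⟩

/-- The function `w ↦ ∫ h(x) P(x, w) dm(x)`. -/
def applyKernel {Y : Type*} [MeasurableSpace Y] (m : Measure Y) (P : Y → Y → ℂ) (h : Y → ℂ)
    (w : Y) : ℂ := ∫ x, h x * P x w ∂m

/-- The composition `(x, w) ↦ ∫ S(x, y) K(y, w) dm(y)` of two kernels. -/
def composeKernel {Y : Type*} [MeasurableSpace Y] (m : Measure Y) (S K : Y → Y → ℂ)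
    (x w : Y) : ℂ := ∫ y, S x y * K y w ∂m

section Bounds

variable {Y : Type*} [MeasurableSpace Y] {m : Measure Y}

theorem applyKernel_smul (P : Y → Y → ℂ) (a : ℂ) (h : Y → ℂ) (w : Y) :
    applyKernel m P (fun x => a * h x) w = a * applyKernel m P h w := by
  simp only [applyKernel, mul_assoc]
  exact integral_const_mul _ _

theorem composeKernel_smul (a : ℂ) (S P : Y → Y → ℂ) (x w : Y) :
    composeKernel m S (fun y w => a * P y w) x w = a * composeKernel m S P x w := by
  simp only [composeKernel, mul_left_comm _ a]
  exact integral_const_mul _ _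

variable [IsFiniteMeasure m]

theorem applyKernel_add [TopologicalSpace Y] {P : Y → Y → ℂ} (hP : IsFredholmKernel m P)
    {h k : Y → ℂ} (hh : IsBddMeas h) (hk : IsBddMeas k) (w : Y) :
    applyKernel m P (fun x => h x + k x) w = applyKernel m P h w + applyKernel m P k w := by
  simp only [applyKernel, add_mul]
  exact integral_add ((hh.mul (hP.isBddMeas w)).integrable m)
    ((hk.mul (hP.isBddMeas w)).integrable m)

theorem norm_integral_mul_le {f g : Y → ℂ} {M N : ℝ} (hf : ∀ x, ‖f x‖ ≤ M)
    (hg : ∀ x, ‖g x‖ ≤ N) : ‖∫ x, f x * g x ∂m‖ ≤ M * N * m.real Set.univ := by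
  refine norm_integral_le_of_norm_le_const (Eventually.of_forall fun x => ?_)
  rw [norm_mul]
  exact mul_le_mul (hf x) (hg x) (norm_nonneg _) ((norm_nonneg _).trans (hf x))

theorem IsFredholmKernel.norm_applyKernel_sub_le [TopologicalSpace Y]
    {P : Y → Y → ℂ} (hP : IsFredholmKernel m P) {h : Y → ℂ}
    (hm : Measurable h) (hh : ∀ x, ‖h x‖ ≤ 1) (w w₀ : Y) :
    ‖applyKernel m P h w - applyKernel m P h w₀‖ ≤ ∫ x, ‖P x w - P x w₀‖ ∂m := by
  have hb : IsBddMeas h := ⟨hm, 1, hh⟩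
  unfold applyKernel
  rw [← integral_sub ((hb.mul (hP.isBddMeas w)).integrable m)
    ((hb.mul (hP.isBddMeas w₀)).integrable m)]
  refine (norm_integral_le_integral_norm _).trans (integral_mono_of_nonneg
    (Eventually.of_forall fun x => norm_nonneg _)
    (((hP.isBddMeas w).sub (hP.isBddMeas w₀)).integrable m).norm
    (Eventually.of_forall fun x => ?_))
  dsimp only
  rw [← mul_sub, norm_mul]
  exact mul_le_of_le_one_left (norm_nonneg _) (hh x)

end Bounds

theorem IsFredholmKernel.add {Y : Type*} [TopologicalSpace Y] [MeasurableSpace Y] {m : Measure Y}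
    {P Q : Y → Y → ℂ} (hP : IsFredholmKernel m P) (hQ : IsFredholmKernel m Q) :
    IsFredholmKernel m fun x w => P x w + Q x w := by
  obtain ⟨M, hM⟩ := hP.bounded
  obtain ⟨N, hN⟩ := hQ.bounded
  refine ⟨fun w => (hP.measurable w).add (hQ.measurable w),
    ⟨M + N, fun x w => (norm_add_le _ _).trans (add_le_add (hM x w) (hN x w))⟩, fun w => ?_⟩
  filter_upwards [hP.ae_continuousAt w, hQ.ae_continuousAt w] with x h1 h2
  exact h1.add h2

theorem isFredholmKernel_of_continuous {Y : Type*} [TopologicalSpace Y] [CompactSpace Y]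
    [MeasurableSpace Y] [OpensMeasurableSpace Y] {m : Measure Y} (Δ : C(Y × Y, ℂ)) :
    IsFredholmKernel m fun y w => Δ (y, w) :=
  ⟨fun w => (Δ.continuous.comp (by fun_prop : Continuous fun y => (y, w))).measurable,
    ⟨‖Δ‖, fun _ _ => Δ.norm_coe_le_norm _⟩, fun w => Eventually.of_forall fun y =>
      (Δ.continuous.comp (by fun_prop : Continuous fun w => (y, w))).continuousAt⟩

section Fredholm

variable {Y : Type*} [TopologicalSpace Y] [FirstCountableTopology Y]
  [MeasurableSpace Y] {m : Measure Y} [IsFiniteMeasure m] {P : Y → Y → ℂ}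

theorem IsFredholmKernel.continuous_applyKernel (hP : IsFredholmKernel m P) {h : Y → ℂ}
    (hh : IsBddMeas h) : Continuous (applyKernel m P h) := by
  obtain ⟨N, hN⟩ := hP.bounded
  obtain ⟨hm, M, hM⟩ := hh
  refine continuous_iff_continuousAt.2 fun w₀ => ?_
  refine tendsto_integral_filter_of_dominated_convergence (fun _ => M * N)
    (Eventually.of_forall fun w => (hm.mul (hP.measurable w)).aestronglyMeasurable)
    (Eventually.of_forall fun w => Eventually.of_forall fun x => ?_) (integrable_const _) ?_
  · rw [norm_mul]
    exact mul_le_mul (hM x) (hN x w) (norm_nonneg _) ((norm_nonneg _).trans (hM x))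
  · filter_upwards [hP.ae_continuousAt w₀] with x hx
    exact hx.tendsto.const_mul (h x)

/-- The modulus of continuity, common to all the images of the unit ball under the integral
operator with kernel `P`. -/
theorem IsFredholmKernel.tendsto_integral_norm_sub (hP : IsFredholmKernel m P) (w₀ : Y) :
    Tendsto (fun w => ∫ x, ‖P x w - P x w₀‖ ∂m) (𝓝 w₀) (𝓝 0) := by
  obtain ⟨N, hN⟩ := hP.bounded
  have : (0 : ℝ) = ∫ x, (fun _ : Y => (0 : ℝ)) x ∂m := by simp
  rw [this]
  refine tendsto_integral_filter_of_dominated_convergence (fun _ => N + N)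
    (Eventually.of_forall fun w =>
      ((hP.measurable w).sub (hP.measurable w₀)).norm.aestronglyMeasurable)
    (Eventually.of_forall fun w => Eventually.of_forall fun x => ?_) (integrable_const _) ?_
  · rw [norm_norm]
    exact (norm_sub_le _ _).trans (add_le_add (hN x w) (hN x w₀))
  · filter_upwards [hP.ae_continuousAt w₀] with x hx
    exact tendsto_iff_norm_sub_tendsto_zero.1 hx.tendsto

/-- Composition with a bounded kernel averages out the discontinuities in the second variable. -/
theorem IsFredholmKernel.compose {S : Y → Y → ℂ} (hP : IsFredholmKernel m P)
    (hS : Measurable (Function.uncurry S))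
    (hSb : ∃ M : ℝ, ∀ x y, ‖S x y‖ ≤ M) : IsFredholmKernel m (composeKernel m S P) := by
  obtain ⟨M, hM⟩ := hSb
  obtain ⟨N, hN⟩ := hP.bounded
  have hSx : ∀ x, IsBddMeas (S x) := fun x => ⟨hS.of_uncurry_left, M, hM x⟩
  refine ⟨fun w => ?_, ⟨M * N * m.real Set.univ, fun x w => norm_integral_mul_le (hM x)
    fun y => hN y w⟩, fun w => Eventually.of_forall fun x =>
    (hP.continuous_applyKernel (hSx x)).continuousAt⟩
  have : Measurable fun p : Y × Y => S p.1 p.2 * P p.2 w :=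
    hS.mul ((hP.measurable w).comp measurable_snd)
  exact this.stronglyMeasurable.integral_prod_right.measurable

variable [CompactSpace Y] [OpensMeasurableSpace Y]

/-- The integral operator with kernel `P`, on continuous functions. -/
def IsFredholmKernel.op (hP : IsFredholmKernel m P) : C(Y, ℂ) →L[ℂ] C(Y, ℂ) :=
  LinearMap.mkContinuousOfExistsBound
    { toFun := fun k => ⟨applyKernel m P k, hP.continuous_applyKernel (isBddMeas_of_continuous k)⟩
      map_add' := fun k l => by
        ext w
        simp only [applyKernel, ContinuousMap.coe_mk, ContinuousMap.add_apply, add_mul]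
        exact integral_add (((isBddMeas_of_continuous k).mul (hP.isBddMeas w)).integrable m)
          (((isBddMeas_of_continuous l).mul (hP.isBddMeas w)).integrable m)
      map_smul' := fun a k => by
        ext w
        simp only [applyKernel, ContinuousMap.coe_mk, ContinuousMap.smul_apply, smul_eq_mul,
          mul_assoc, RingHom.id_apply]
        exact integral_const_mul _ _ }
    (by
      obtain ⟨N, hN⟩ := hP.bounded
      refine ⟨max N 0 * m.real Set.univ, fun k => ?_⟩
      refine (ContinuousMap.norm_le _ (by positivity)).2 fun w => ?_
      refine (norm_integral_mul_le k.norm_coe_le_norm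
        fun x => (hN x w).trans (le_max_left N 0)).trans (le_of_eq ?_)
      ring)

/-- The image of the unit ball is bounded and equicontinuous, hence relatively compact. -/
theorem IsFredholmKernel.isCompactOperator_op (hP : IsFredholmKernel m P) :
    IsCompactOperator hP.op := by
  refine (isCompactOperator_iff_exists_mem_nhds_image_subset_compact _).2
    ⟨Metric.closedBall 0 1, Metric.closedBall_mem_nhds _ one_pos, ?_⟩
  -- The images of the unit ball lie in the set `A` of functions that are bounded by the operator
  -- norm and have the common modulus of continuity `ω`. As a subset of the product space it is
  -- compact, so Arzelà–Ascoli applies.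
  let ω : Y → Y → ℝ := fun w w₀ => ∫ x, ‖P x w - P x w₀‖ ∂m
  let A : Set (Y → ℂ) := {f | (∀ w, f w ∈ Metric.closedBall (0 : ℂ) ‖hP.op‖) ∧
    ∀ w w₀, ‖f w - f w₀‖ ≤ ω w w₀}
  have hA : IsCompact A := by
    have h1 : IsCompact {f : Y → ℂ | ∀ w, f w ∈ Metric.closedBall (0 : ℂ) ‖hP.op‖} :=
      isCompact_pi_infinite fun _ => isCompact_closedBall _ _
    have h2 : IsClosed {f : Y → ℂ | ∀ w w₀, ‖f w - f w₀‖ ≤ ω w w₀} := by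
      have : {f : Y → ℂ | ∀ w w₀, ‖f w - f w₀‖ ≤ ω w w₀} =
          ⋂ w, ⋂ w₀, {f : Y → ℂ | ‖f w - f w₀‖ ≤ ω w w₀} := by
        ext f; simp
      rw [this]
      exact isClosed_iInter fun w => isClosed_iInter fun w₀ =>
        isClosed_le ((continuous_apply w).sub (continuous_apply w₀)).norm continuous_const
    exact h1.inter_right h2
  have hequi : ∀ w₀, ∀ ε > 0, ∀ᶠ w in 𝓝 w₀, ∀ f ∈ A, ‖f w - f w₀‖ < ε := by
    intro w₀ ε hε
    filter_upwards [(hP.tendsto_integral_norm_sub w₀).eventually_lt_const hε] with w hw f hf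
    exact (hf.2 w w₀).trans_lt hw
  have hcont : ∀ f ∈ A, Continuous f := fun f hf => continuous_iff_continuousAt.2 fun w₀ =>
    Metric.tendsto_nhds.2 fun ε hε => (hequi w₀ ε hε).mono fun w hw => by
      rw [dist_eq_norm]; exact hw f hf
  let B : Set C(Y, ℂ) := {f | ⇑f ∈ A}
  have hB : ContinuousMap.toFun '' B = A :=
    Set.Subset.antisymm (by rintro _ ⟨f, hf, rfl⟩; exact hf)
      fun f hf => ⟨⟨f, hcont f hf⟩, hf, rfl⟩
  refine ⟨B, ArzelaAscoli.isCompact_of_equicontinuous B (hB ▸ hA) fun w₀ => ?_, ?_⟩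
  · refine Metric.equicontinuousAt_iff_right.2 fun ε hε => ?_
    filter_upwards [hequi w₀ ε hε] with w hw f
    rw [dist_comm, dist_eq_norm]
    exact hw _ f.2
  · rintro _ ⟨k, hk, rfl⟩
    rw [mem_closedBall_zero_iff] at hk
    refine ⟨fun w => ?_, fun w w₀ => ?_⟩
    · rw [mem_closedBall_zero_iff]
      exact ((hP.op k).norm_coe_le_norm w).trans
        ((hP.op.le_opNorm k).trans (mul_le_of_le_one_right (norm_nonneg _) hk))
    · exact hP.norm_applyKernel_sub_le k.continuous.measurable
        (fun x => (k.norm_coe_le_norm x).trans hk) w w₀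

/-- The Fredholm alternative: uniqueness implies unique solvability. -/
theorem IsFredholmKernel.isUnit_one_sub_op (hP : IsFredholmKernel m P)
    (hinj : ∀ k, hP.op k = k → k = 0) : IsUnit (1 - hP.op) := by
  rcases hP.isCompactOperator_op.hasEigenvalue_or_mem_resolventSet
    (one_ne_zero (α := ℂ)) with h | h
  · obtain ⟨k, hk⟩ := h.exists_hasEigenvector
    exact absurd (hinj k (by simpa using hk.apply_eq_smul)) hk.2
  · simpa [spectrum.mem_resolventSet_iff] using h

end Fredholm

/-- The term with the derivative of `A` drops out of the product rule, since `L` vanishes at `0`. -/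
theorem hasDerivAt_apply_apply_zero {E F : Type*} [NormedAddCommGroup E] [NormedSpace ℂ E]
    [NormedAddCommGroup F] [NormedSpace ℂ F] {A : E → F →L[ℂ] F} {A' : E →L[ℂ] F →L[ℂ] F}
    (hA : HasFDerivAt A A' 0) (L : E →L[ℂ] F) {e : ℝ → E} {e' : E} (he0 : e 0 = 0)
    (he : HasDerivAt e e' 0) : HasDerivAt (fun x => A (e x) (L (e x))) (A 0 (L e')) 0 := by
  have h := (hA.clm_apply L.hasFDerivAt).restrictScalars ℝ
  rw [← he0] at h
  refine (h.comp_hasDerivAt (0 : ℝ) he).congr_deriv ?_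
  simp [he0]

/-! ### Dyson equations and their continuous perturbations -/

/-- The data of a scalar Dyson equation `G = K + G S K`: a bounded self-energy `S` and a
bare kernel `K`. -/
structure DysonKernels {Y : Type*} [TopologicalSpace Y] [MeasurableSpace Y] (m : Measure Y) where
  /-- the self-energy -/
  S : Y → Y → ℂ
  /-- the bare kernel -/
  K : Y → Y → ℂ
  measurable_S : Measurable (Function.uncurry S)
  bounded_S : ∃ M : ℝ, ∀ x y, ‖S x y‖ ≤ M
  isFredholmKernel_K : IsFredholmKernel m K

namespace DysonKernels

variable {Y : Type*} [TopologicalSpace Y] [MeasurableSpace Y] {m : Measure Y}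

variable (D : DysonKernels m)

/-- `G` is, as a function of its second argument, a solution of
`G(z, w) = C(z, w) + ∬ G(z, x) S(x, y) C(y, w)` for the bare kernel `C = K + Δ`. -/
def SolvesRow (Δ : C(Y × Y, ℂ)) (z : Y) (G : Y → ℂ) : Prop :=
  IsBddMeas G ∧ ∀ w, G w = K D z w + Δ (z, w) +
    applyKernel m (composeKernel m D.S fun y w => K D y w + Δ (y, w)) G w

theorem isBddMeas_S (x : Y) : IsBddMeas (D.S x) :=
  ⟨D.measurable_S.of_uncurry_left, D.bounded_S.imp fun _ h => h x⟩

theorem applyKernel_compose_smul (a : ℂ) (P : Y → Y → ℂ) (h : Y → ℂ) (w : Y) :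
    applyKernel m (composeKernel m D.S fun y w => a * P y w) h w =
      a * applyKernel m (composeKernel m D.S P) h w := by
  simp only [applyKernel, composeKernel_smul, mul_left_comm _ a]
  exact integral_const_mul _ _

variable [IsFiniteMeasure m]

theorem composeKernel_add {P Q : Y → Y → ℂ} (hP : IsFredholmKernel m P)
    (hQ : IsFredholmKernel m Q) (x w : Y) :
    composeKernel m D.S (fun y w => P y w + Q y w) x w =
      composeKernel m D.S P x w + composeKernel m D.S Q x w := by
  simp only [composeKernel, mul_add]
  exact integral_add (((D.isBddMeas_S x).mul (hP.isBddMeas w)).integrable m)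
    (((D.isBddMeas_S x).mul (hQ.isBddMeas w)).integrable m)

/-- A bound for the double integrals `∬ h(x) S(x, y) Δ(y, w)`. -/
theorem exists_norm_applyKernel_compose_le [CompactSpace Y] :
    ∃ N : ℝ, 0 ≤ N ∧ ∀ (Δ : C(Y × Y, ℂ)) (h : Y → ℂ) (M : ℝ), (∀ x, ‖h x‖ ≤ M) → ∀ w,
      ‖applyKernel m (composeKernel m D.S fun y w => Δ (y, w)) h w‖ ≤ N * M * ‖Δ‖ := by
  obtain ⟨B, hB⟩ := D.bounded_S
  refine ⟨max B 0 * m.real Set.univ * m.real Set.univ, by positivity, fun Δ h M hM w => ?_⟩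
  refine (norm_integral_mul_le hM fun x => norm_integral_mul_le
    (fun y => (hB x y).trans (le_max_left B 0))
    fun y => Δ.norm_coe_le_norm (y, w)).trans (le_of_eq ?_)
  ring

variable [FirstCountableTopology Y]

theorem isFredholmKernel_compose {P : Y → Y → ℂ} (hP : IsFredholmKernel m P) :
    IsFredholmKernel m (composeKernel m D.S P) :=
  hP.compose D.measurable_S D.bounded_S

theorem applyKernel_compose_add {P Q : Y → Y → ℂ} (hP : IsFredholmKernel m P)
    (hQ : IsFredholmKernel m Q) {h : Y → ℂ} (hh : IsBddMeas h) (w : Y) :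
    applyKernel m (composeKernel m D.S fun y w => P y w + Q y w) h w =
      applyKernel m (composeKernel m D.S P) h w + applyKernel m (composeKernel m D.S Q) h w := by
  simp only [applyKernel, D.composeKernel_add hP hQ, mul_add]
  exact integral_add ((hh.mul ((D.isFredholmKernel_compose hP).isBddMeas w)).integrable m)
    ((hh.mul ((D.isFredholmKernel_compose hQ).isBddMeas w)).integrable m)

variable [CompactSpace Y] [OpensMeasurableSpace Y]

/-- The operator `k ↦ k S K` on continuous functions. -/
def op : C(Y, ℂ) →L[ℂ] C(Y, ℂ) := (D.isFredholmKernel_compose D.isFredholmKernel_K).op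

/-- The perturbation `(Δ, k) ↦ k S Δ` of the operator of the Dyson equation. -/
def perturb : C(Y × Y, ℂ) →L[ℂ] C(Y, ℂ) →L[ℂ] C(Y, ℂ) :=
  LinearMap.mkContinuous₂
    (LinearMap.mk₂ ℂ (fun Δ k => ⟨applyKernel m (composeKernel m D.S fun y w => Δ (y, w)) k,
        (D.isFredholmKernel_compose (isFredholmKernel_of_continuous Δ)).continuous_applyKernel
          (isBddMeas_of_continuous k)⟩)
      (fun Δ Δ' k => ContinuousMap.ext fun w => D.applyKernel_compose_add
        (isFredholmKernel_of_continuous Δ) (isFredholmKernel_of_continuous Δ')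
        (isBddMeas_of_continuous k) w)
      (fun a Δ k => ContinuousMap.ext fun w => D.applyKernel_compose_smul a _ _ w)
      (fun Δ k k' => ContinuousMap.ext fun w => applyKernel_add
        (D.isFredholmKernel_compose (isFredholmKernel_of_continuous Δ))
        (isBddMeas_of_continuous k) (isBddMeas_of_continuous k') w)
      (fun a Δ k => ContinuousMap.ext fun w => applyKernel_smul _ a _ w))
    D.exists_norm_applyKernel_compose_le.choose
    (by
      obtain ⟨hN0, hN⟩ := D.exists_norm_applyKernel_compose_le.choose_spec
      refine fun Δ k => (ContinuousMap.norm_le _ (by positivity)).2 fun w => ?_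
      refine (hN Δ k ‖k‖ k.norm_coe_le_norm w).trans (le_of_eq ?_)
      ring)

/-- The inhomogeneity `Δ(z, ·) + h S Δ` of the equation for the difference between a perturbed
solution and the unperturbed solution `h`. -/
def forcing (z : Y) {h : Y → ℂ} (hh : IsBddMeas h) : C(Y × Y, ℂ) →L[ℂ] C(Y, ℂ) :=
  LinearMap.mkContinuousOfExistsBound
    { toFun := fun Δ => ⟨fun w => Δ (z, w) +
          applyKernel m (composeKernel m D.S fun y w => Δ (y, w)) h w,
        (by fun_prop : Continuous fun w => Δ (z, w)).add
          ((D.isFredholmKernel_compose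
            (isFredholmKernel_of_continuous Δ)).continuous_applyKernel hh)⟩
      map_add' := fun Δ Δ' => ContinuousMap.ext fun w => by
        have := D.applyKernel_compose_add (isFredholmKernel_of_continuous Δ)
          (isFredholmKernel_of_continuous Δ') hh w
        simp only [ContinuousMap.coe_mk, ContinuousMap.add_apply, this]
        ring
      map_smul' := fun a Δ => ContinuousMap.ext fun w => by
        have := D.applyKernel_compose_smul a (fun y w => Δ (y, w)) h w
        simp only [ContinuousMap.coe_mk, ContinuousMap.smul_apply, this, smul_eq_mul,
          RingHom.id_apply]
        ring }
    (by
      obtain ⟨N, hN0, hN⟩ := D.exists_norm_applyKernel_compose_le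
      obtain ⟨M, hM⟩ := hh.2
      refine ⟨1 + N * max M 0, fun Δ => (ContinuousMap.norm_le _ (by positivity)).2 fun w => ?_⟩
      refine (norm_add_le _ _).trans ((add_le_add (Δ.norm_coe_le_norm (z, w))
        (hN Δ h (max M 0) (fun x => (hM x).trans (le_max_left M 0)) w)).trans (le_of_eq ?_))
      ring)

theorem forcing_apply (z : Y) {h : Y → ℂ} (hh : IsBddMeas h) (Δ : C(Y × Y, ℂ)) (w : Y) :
    D.forcing z hh Δ w =
      Δ (z, w) + applyKernel m (composeKernel m D.S fun y w => Δ (y, w)) h w := rfl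

variable {D}

theorem applyKernel_perturbed (Δ : C(Y × Y, ℂ)) {h : Y → ℂ} (hh : IsBddMeas h) (w : Y) :
    applyKernel m (composeKernel m D.S fun y w => D.K y w + Δ (y, w)) h w =
      applyKernel m (composeKernel m D.S D.K) h w +
        applyKernel m (composeKernel m D.S fun y w => Δ (y, w)) h w :=
  D.applyKernel_compose_add D.isFredholmKernel_K (isFredholmKernel_of_continuous Δ) hh w

/-- The solutions for the bare kernel `K + Δ` are `G + k`, with `G` a solution for the bare kernel
`K` and `k` continuous: although `K` and `G` may be discontinuous, the integral term of the equation
is continuous. -/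
theorem solvesRow_iff {z : Y} {G : Y → ℂ} (hG : D.SolvesRow 0 z G) (Δ : C(Y × Y, ℂ))
    (H : Y → ℂ) : D.SolvesRow Δ z H ↔ ∃ k : C(Y, ℂ),
      (1 - D.op - D.perturb Δ) k = D.forcing z hG.1 Δ ∧ ∀ w, H w = G w + k w := by
  have hG' : ∀ w, G w = D.K z w + applyKernel m (composeKernel m D.S D.K) G w := fun w => by
    simpa using hG.2 w
  have key : ∀ k : C(Y, ℂ), ∀ w,
      applyKernel m (composeKernel m D.S fun y w => D.K y w + Δ (y, w)) (fun x => G x + k x) w =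
      applyKernel m (composeKernel m D.S D.K) G w + D.op k w
        + (applyKernel m (composeKernel m D.S fun y w => Δ (y, w)) G w + D.perturb Δ k w) := by
    intro k w
    have hk := isBddMeas_of_continuous k
    rw [applyKernel_perturbed Δ (hG.1.add hk), applyKernel_add
      (D.isFredholmKernel_compose D.isFredholmKernel_K) hG.1 hk, applyKernel_add
      (D.isFredholmKernel_compose (isFredholmKernel_of_continuous Δ)) hG.1 hk]
    rfl
  constructor
  · rintro ⟨hb, hH⟩
    have hcont : Continuous fun w => H w - G w := by
      have h1 : Continuous (applyKernel m
          (composeKernel m D.S fun y w => D.K y w + Δ (y, w)) H) := by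
        have := ((D.isFredholmKernel_compose D.isFredholmKernel_K).continuous_applyKernel hb).add
          ((D.isFredholmKernel_compose
            (isFredholmKernel_of_continuous Δ)).continuous_applyKernel hb)
        exact this.congr fun w => (applyKernel_perturbed Δ hb w).symm
      have h2 := (D.isFredholmKernel_compose D.isFredholmKernel_K).continuous_applyKernel hG.1
      have h3 : Continuous fun w => Δ (z, w) := by fun_prop
      refine ((h3.add h1).sub h2).congr fun w => ?_
      simp only [Pi.sub_apply, Pi.add_apply]
      linear_combination hG' w - hH w
    let k : C(Y, ℂ) := ⟨_, hcont⟩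
    have hHk : H = fun w => G w + k w := funext fun w => (add_sub_cancel (G w) (H w)).symm
    refine ⟨k, ContinuousMap.ext fun w => ?_, fun w => congrFun hHk w⟩
    have h1 := hH w
    rw [hHk, key] at h1
    have h2 := hG' w
    simp only [sub_apply, one_apply_eq_self,
      ContinuousMap.sub_apply, forcing_apply]
    linear_combination h1 - h2
  · rintro ⟨k, hk, hH⟩
    have hHk : H = fun w => G w + k w := funext hH
    refine ⟨hHk ▸ hG.1.add (isBddMeas_of_continuous k), fun w => ?_⟩
    have h1 := DFunLike.congr_fun hk w
    have h2 := hG' w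
    simp only [sub_apply, one_apply_eq_self,
      ContinuousMap.sub_apply, forcing_apply] at h1
    rw [hHk, key]
    linear_combination h1 + h2

/-- The difference between the solution for the bare kernel `K + Δ` and the solution `G` for the
bare kernel `K`. -/
def correction (D : DysonKernels m) (z : Y) {G : Y → ℂ} (hG : IsBddMeas G)
    (Δ : C(Y × Y, ℂ)) : C(Y, ℂ) :=
  Ring.inverse (1 - D.op - D.perturb Δ) (D.forcing z hG Δ)

theorem solvesRow_iff_of_isUnit {z : Y} {G : Y → ℂ} (hG : D.SolvesRow 0 z G) {Δ : C(Y × Y, ℂ)}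
    (hu : IsUnit (1 - D.op - D.perturb Δ)) (H : Y → ℂ) :
    D.SolvesRow Δ z H ↔ ∀ w, H w = G w + D.correction z hG.1 Δ w := by
  rw [solvesRow_iff hG]
  constructor
  · rintro ⟨k, hk, hH⟩
    have : k = D.correction z hG.1 Δ := by
      rw [correction, ← hk, ← mul_apply_eq_comp, Ring.inverse_mul_cancel _ hu,
        one_apply_eq_self]
    exact this ▸ hH
  · intro h
    refine ⟨_, ?_, h⟩
    rw [correction, ← mul_apply_eq_comp, Ring.mul_inverse_cancel _ hu,
        one_apply_eq_self]

theorem eventually_isUnit (hu : IsUnit (1 - D.op)) :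
    ∀ᶠ Δ in 𝓝 (0 : C(Y × Y, ℂ)), IsUnit (1 - D.op - D.perturb Δ) := by
  have hc : Continuous fun Δ => 1 - D.op - D.perturb Δ :=
    continuous_const.sub D.perturb.continuous
  have h0 : {T : C(Y, ℂ) →L[ℂ] C(Y, ℂ) | IsUnit T} ∈ 𝓝 (1 - D.op - D.perturb 0) :=
    (Units.isOpen (R := C(Y, ℂ) →L[ℂ] C(Y, ℂ))).mem_nhds (by simpa using hu)
  exact hc.continuousAt h0

/-- The correction is differentiable in the perturbation, and its derivative solves the
linearized Dyson equation. -/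
theorem hasDerivAt_correction (hu : IsUnit (1 - D.op)) (z : Y) {G : Y → ℂ} (hG : IsBddMeas G)
    {Δ : ℝ → C(Y × Y, ℂ)} {Δ' : C(Y × Y, ℂ)} (hΔ0 : Δ 0 = 0) (hΔ : HasDerivAt Δ Δ' 0) :
    ∃ k : C(Y, ℂ), HasDerivAt (fun x => D.correction z hG (Δ x)) k 0 ∧
      k = D.op k + D.forcing z hG Δ' := by
  refine ⟨Ring.inverse (1 - D.op) (D.forcing z hG Δ'), ?_, ?_⟩
  · obtain ⟨u, hu⟩ := hu
    have h0 : HasFDerivAt (fun Δ => 1 - D.op - D.perturb Δ) (-D.perturb) 0 :=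
      HasFDerivAt.const_sub (F := C(Y, ℂ) →L[ℂ] C(Y, ℂ)) D.perturb.hasFDerivAt (1 - D.op)
    have hinv := hasFDerivAt_ringInverse (𝕜 := ℂ) (R := C(Y, ℂ) →L[ℂ] C(Y, ℂ)) u
    rw [hu, ← sub_zero (1 - D.op), ← map_zero D.perturb] at hinv
    have h1 := HasFDerivAt.comp (F := C(Y, ℂ) →L[ℂ] C(Y, ℂ)) (G := C(Y, ℂ) →L[ℂ] C(Y, ℂ))
      (0 : C(Y × Y, ℂ)) hinv h0
    have h2 := hasDerivAt_apply_apply_zero h1 (D.forcing z hG) hΔ0 hΔ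
    rw [Function.comp_apply, map_zero, sub_zero] at h2
    exact h2
  · have : (1 - D.op) (Ring.inverse (1 - D.op) (D.forcing z hG Δ')) = D.forcing z hG Δ' := by
      rw [← mul_apply_eq_comp, Ring.mul_inverse_cancel _ hu, one_apply_eq_self]
    rw [sub_apply, one_apply_eq_self] at this
    exact sub_eq_iff_eq_add'.1 this

end DysonKernels

/-! ### Differentiation of continuous families in the supremum norm -/

/-- A continuously differentiable family of continuous functions on a compact space is differentiable
in the supremum norm: it is the integral of its derivative. -/
theorem hasDerivAt_curry {Z : Type*} [TopologicalSpace Z] [CompactSpace Z] (f f' : C(ℝ × Z, ℂ))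
    (h : ∀ x z, HasDerivAt (fun x => f (x, z)) (f' (x, z)) x) (x : ℝ) :
    HasDerivAt (fun x => f.curry x) (f'.curry x) x := by
  have hc : Continuous fun x => f'.curry x := f'.curry.continuous
  have hint : (fun x => f.curry x) = fun x => f.curry 0 + ∫ ξ in (0 : ℝ)..x, f'.curry ξ := by
    funext x
    refine ContinuousMap.ext fun z => ?_
    have h1 := (ContinuousMap.evalCLM ℂ z).intervalIntegral_comp_comm
      (hc.intervalIntegrable (μ := volume) 0 x)
    have h2 := intervalIntegral.integral_eq_sub_of_hasDerivAt (a := 0) (b := x)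
      (fun ξ _ => h ξ z)
      ((f'.continuous.comp (by fun_prop : Continuous fun ξ : ℝ => (ξ, z))).intervalIntegrable _ _)
    simp only [ContinuousMap.evalCLM_apply, ContinuousMap.curry_apply] at h1
    rw [ContinuousMap.add_apply, ← h1, ContinuousMap.curry_apply, ContinuousMap.curry_apply, h2]
    ring
  rw [hint]
  exact (hc.integral_hasStrictDerivAt 0 x).hasDerivAt.const_add _

/-! ### The contour as a measure space with finitely many channels -/

instance : TopologicalSpace Branch := ⊥
instance : DiscreteTopology Branch := ⟨rfl⟩
instance : MeasurableSpace Branch := ⊤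
instance : MeasurableSingletonClass Branch := ⟨fun _ => trivial⟩
instance : DecidableEq Branch
  | .backward, .backward => isTrue rfl
  | .forward, .forward => isTrue rfl
  | .backward, .forward => isFalse nofun
  | .forward, .backward => isFalse nofun
instance : Fintype Branch :=
  ⟨{.backward, .forward}, fun b => by cases b <;> simp⟩

/-- The points of the contour together with a matrix index. Matrix-valued contour kernels are
scalar kernels on this space. -/
abbrev IndexedContour (R : ℕ) (t : ℝ) := (Branch × Idx R) × Set.Icc (0 : ℝ) t

/-- The underlying point of the contour. -/
abbrev IndexedContour.point {R : ℕ} {t : ℝ} (y : IndexedContour R t) : Contour t := (y.1.1, y.2)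

/-- The product of the counting measure and the Lebesgue measure. -/
def contourMeasure (R : ℕ) (t : ℝ) : Measure (IndexedContour R t) :=
  (Measure.count : Measure (Branch × Idx R)).prod (timeMeasure t)

instance (t : ℝ) : IsFiniteMeasure (timeMeasure t) where
  measure_univ_lt_top := by
    rw [timeMeasure, comap_subtype_coe_apply measurableSet_Icc, Set.image_univ,
      Subtype.range_coe]
    exact measure_Icc_lt_top

theorem timeMeasure_singleton {t : ℝ} (τ : Set.Icc (0 : ℝ) t) : timeMeasure t {τ} = 0 := by
  rw [timeMeasure, comap_subtype_coe_apply measurableSet_Icc]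
  simp

instance (R : ℕ) (t : ℝ) : IsFiniteMeasure (contourMeasure R t) :=
  inferInstanceAs (IsFiniteMeasure (Measure.prod _ _))

/-- The scalar form of a matrix-valued contour kernel. -/
def Kernel.scalar {R : ℕ} {t : ℝ} (F : Kernel R t) (y w : IndexedContour R t) : ℂ :=
  F y.point w.point y.1.2 w.1.2

theorem ae_time_ne {R : ℕ} {t : ℝ} (τ : Set.Icc (0 : ℝ) t) :
    ∀ᵐ y ∂contourMeasure R t, y.2 ≠ τ :=
  Measure.quasiMeasurePreserving_snd.ae
    (by simp [ae_iff, timeMeasure_singleton] : ∀ᵐ s ∂timeMeasure t, s ≠ τ)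

theorem continuous_of_discrete {A D T X : Type*} [TopologicalSpace A] [TopologicalSpace D]
    [DiscreteTopology D] [TopologicalSpace T] [TopologicalSpace X] {f : A × ((D × T) × (D × T)) → X}
    (h : ∀ d d', Continuous fun q : A × T × T => f (q.1, ((d, q.2.1), (d', q.2.2)))) :
    Continuous f := by
  have h1 : Continuous fun q : (D × D) × (A × T × T) =>
      f (q.2.1, ((q.1.1, q.2.2.1), (q.1.2, q.2.2.2))) :=
    continuous_prod_of_discrete_left.2 fun d => h d.1 d.2
  exact h1.comp (by fun_prop : Continuous fun p : A × ((D × T) × (D × T)) =>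
    ((p.2.1.1, p.2.2.1), (p.1, p.2.1.2, p.2.2.2)))

theorem measurable_of_discrete {D T X : Type*} [MeasurableSpace D] [MeasurableSingletonClass D]
    [Countable D] [MeasurableSpace T] [MeasurableSpace X] {f : (D × T) × (D × T) → X}
    (h : ∀ d d', Measurable fun q : T × T => f ((d, q.1), (d', q.2))) : Measurable f := by
  have h1 : Measurable fun q : (D × D) × (T × T) => f ((q.1.1, q.2.1), (q.1.2, q.2.2)) :=
    measurable_from_prod_countable_right fun d => h d.1 d.2
  exact h1.comp (by fun_prop : Measurable fun p : (D × T) × (D × T) =>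
    ((p.1.1, p.2.1), (p.1.2, p.2.2)))

/-- A family of continuous functions of two times, as a continuous function on pairs of points. -/
def timeFamily {R : ℕ} (t : ℝ) (f : Idx R → Idx R → ℝ → ℝ → ℂ)
    (hf : ∀ μ ν, Continuous fun p : ℝ × ℝ => f μ ν p.1 p.2) :
    C(IndexedContour R t × IndexedContour R t, ℂ) where
  toFun p := f p.1.1.2 p.2.1.2 p.1.2 p.2.2
  continuous_toFun := by
    have : Continuous fun q : Unit × (IndexedContour R t × IndexedContour R t) =>
        f q.2.1.1.2 q.2.2.1.2 q.2.1.2 q.2.2.2 :=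
      continuous_of_discrete fun d d' => (hf d.2 d'.2).comp (by fun_prop :
        Continuous fun q : Unit × Set.Icc (0 : ℝ) t × Set.Icc (0 : ℝ) t =>
          ((q.2.1 : ℝ), (q.2.2 : ℝ)))
    exact this.comp (by fun_prop : Continuous fun p => ((), p))

/-! ### Contour order -/

theorem contourStep_forward {t : ℝ} (x y : Set.Icc (0 : ℝ) t) :
    contourStep (.forward, x) (.forward, y) = if y < x then 1 else if x = y then 1 / 2 else 0 := by
  simp [contourStep, Contour.precedes]

theorem contourStep_backward {t : ℝ} (x y : Set.Icc (0 : ℝ) t) :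
    contourStep (.backward, x) (.backward, y) =
      if x < y then 1 else if x = y then 1 / 2 else 0 := by
  simp [contourStep, Contour.precedes]

theorem norm_contourStep_le {t : ℝ} (z w : Contour t) : ‖contourStep z w‖ ≤ 1 := by
  unfold contourStep
  split_ifs <;> norm_num

theorem measurable_contourStep_same {t : ℝ} (b : Branch) :
    Measurable fun q : Set.Icc (0 : ℝ) t × Set.Icc (0 : ℝ) t =>
      contourStep (b, q.1) (b, q.2) := by
  have hd := measurableSet_eq_fun (measurable_fst (α := Set.Icc (0 : ℝ) t)
    (β := Set.Icc (0 : ℝ) t)) measurable_snd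
  cases b
  · simp only [contourStep_backward]
    exact Measurable.ite (measurableSet_lt measurable_fst measurable_snd) measurable_const
      (Measurable.ite hd measurable_const measurable_const)
  · simp only [contourStep_forward]
    exact Measurable.ite (measurableSet_lt measurable_snd measurable_fst) measurable_const
      (Measurable.ite hd measurable_const measurable_const)

/-- The weight of `X(z) Y(w)` in a contour-ordered product. Since operators on `γ_+` act to the
right of the state, cyclicity moves them to the left of those on `γ_-`. -/
def orderWeight {t : ℝ} (z w : Contour t) : ℂ :=
  match z.1, w.1 with
  | .backward, .forward => 1
  | .forward, .backward => 0
  | .forward, .forward => contourStep z w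
  | .backward, .backward => contourStep z w

theorem norm_orderWeight_le {t : ℝ} (z w : Contour t) : ‖orderWeight z w‖ ≤ 1 := by
  obtain ⟨b, x⟩ := z
  obtain ⟨b', y⟩ := w
  cases b <;> cases b' <;> simp [orderWeight, norm_contourStep_le]

theorem measurable_orderWeight (R : ℕ) (t : ℝ) :
    Measurable fun p : IndexedContour R t × IndexedContour R t =>
      orderWeight p.1.point p.2.point := by
  refine measurable_of_discrete ?_
  rintro ⟨b, μ⟩ ⟨b', ν⟩
  cases b <;> cases b' <;> simp [orderWeight, IndexedContour.point, measurable_contourStep_same]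

/-- Away from coinciding times the contour order is locally constant. -/
theorem eventually_orderWeight_eq {R : ℕ} {t : ℝ} {y w : IndexedContour R t} (h : y.2 ≠ w.2) :
    ∀ᶠ w' in 𝓝 w, orderWeight y.point w'.point = orderWeight y.point w.point ∧
      orderWeight w'.point y.point = orderWeight w.point y.point := by
  have h1 : ∀ᶠ w' in 𝓝 w, w'.1 = w.1 :=
    continuous_fst.continuousAt.eventually
      (show ∀ᶠ d in 𝓝 w.1, d = w.1 by rw [nhds_discrete]; rfl)
  obtain ⟨⟨b, μ⟩, τ⟩ := y
  obtain ⟨⟨b', ν⟩, τ'⟩ := w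
  dsimp only at h h1
  rcases lt_or_gt_of_ne h with h | h
  · filter_upwards [h1, continuous_snd.continuousAt.eventually (lt_mem_nhds h)] with w' h1 h2
    obtain ⟨⟨c, κ⟩, σ⟩ := w'
    obtain ⟨rfl, rfl⟩ := Prod.mk.inj h1
    dsimp only at h2
    cases b <;> cases c <;> simp [orderWeight, IndexedContour.point, contourStep_forward,
      contourStep_backward, h, h2, h.not_gt, h2.not_gt, h.ne, h.ne', h2.ne, h2.ne']
  · filter_upwards [h1, continuous_snd.continuousAt.eventually (gt_mem_nhds h)] with w' h1 h2
    obtain ⟨⟨c, κ⟩, σ⟩ := w'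
    obtain ⟨rfl, rfl⟩ := Prod.mk.inj h1
    dsimp only at h2
    cases b <;> cases c <;> simp [orderWeight, IndexedContour.point, contourStep_forward,
      contourStep_backward, h, h2, h.not_gt, h2.not_gt, h.ne, h.ne', h2.ne, h2.ne']

/-! ### Statistics and conjugate indices -/

theorem Statistics.sign_mul_self (ζ : Statistics) : ζ.sign * ζ.sign = 1 := by
  cases ζ <;> simp [Statistics.sign]

theorem Statistics.conj_sign (ζ : Statistics) : conj ζ.sign = ζ.sign := by
  cases ζ <;> simp [Statistics.sign]

/-- The index of the adjoint coupling operator. -/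
def Idx.bar {R : ℕ} (μ : Idx R) : Idx R := (μ.1, 1 - μ.2)

@[simp]
theorem Idx.bar_bar {R : ℕ} (μ : Idx R) : μ.bar.bar = μ := by
  obtain ⟨α, i⟩ := μ
  fin_cases i <;> simp [Idx.bar]

theorem effConj_apply {R : ℕ} (ζ : Statistics) (F : Matrix (Idx R) (Idx R) ℂ) (μ ν : Idx R) :
    effConj ζ F μ ν = ζ.sign * conj (F μ.bar ν.bar) := by
  obtain ⟨α, i⟩ := μ
  obtain ⟨β, j⟩ := ν
  simp only [effConj, Matrix.smul_apply, smul_eq_mul, Matrix.mul_apply, Matrix.map_apply,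
    Fintype.sum_prod_type, Matrix.kroneckerMap_apply, Matrix.one_apply, Idx.bar]
  fin_cases i <;> fin_cases j <;> simp

theorem effConj_add {R : ℕ} (ζ : Statistics) (F F' : Matrix (Idx R) (Idx R) ℂ) :
    effConj ζ (F + F') = effConj ζ F + effConj ζ F' := by
  ext μ ν
  simp [effConj_apply, mul_add]

theorem effConj_neg {R : ℕ} (ζ : Statistics) (F : Matrix (Idx R) (Idx R) ℂ) :
    effConj ζ (-F) = -effConj ζ F := by
  ext μ ν
  simp [effConj_apply]

/-- Effective conjugation is multiplicative on products of three factors, because `ζ³ = ζ`. -/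
theorem effConj_mul_mul {R : ℕ} (ζ : Statistics) (F F' F'' : Matrix (Idx R) (Idx R) ℂ) :
    effConj ζ (F * F' * F'') = effConj ζ F * effConj ζ F' * effConj ζ F'' := by
  let e : Idx R ≃ Idx R := ⟨Idx.bar, Idx.bar, Idx.bar_bar, Idx.bar_bar⟩
  ext μ ν
  simp only [effConj_apply, Matrix.mul_apply, map_sum, map_mul, Finset.mul_sum, Finset.sum_mul]
  refine (Fintype.sum_equiv e _ _ fun κ => Fintype.sum_equiv e _ _ fun σ => ?_).symm
  simp only [e, Equiv.coe_fn_mk]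
  linear_combination (ζ.sign * conj (F μ.bar σ.bar) * conj (F' σ.bar κ.bar) *
    conj (F'' κ.bar ν.bar)) * ζ.sign_mul_self

/-! ### Correlation functions of the environment -/

section Environment

variable {ζ : Statistics} {R : ℕ} {𝔥 : Fin R → Type*}
  [∀ α, NormedAddCommGroup (𝔥 α)] [∀ α, InnerProductSpace ℂ (𝔥 α)]
  {𝔄 : Type*} [Ring 𝔄] [StarRing 𝔄] [Algebra ℂ 𝔄] [StarModule ℂ 𝔄]

namespace Environment

variable (E : Environment ζ R 𝔥 𝔄)

theorem star_op (μ : Idx R) (s : ℝ) : star (E.op μ s) = E.op μ.bar s := by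
  obtain ⟨α, i⟩ := μ
  unfold op
  rw [← map_star]
  congr 1
  fin_cases i <;> simp [couplingOp, Idx.bar] <;> rfl

theorem star_grandFlow (s : Fin R → ℝ) (X : 𝔄) :
    star (E.grandFlow s X) = E.grandFlow s (star X) := by
  simp [grandFlow, map_star]

theorem grandFlow_mul (s : Fin R → ℝ) (X Y : 𝔄) :
    E.grandFlow s (X * Y) = E.grandFlow s X * E.grandFlow s Y := by
  simp [grandFlow]

/-- The initial state is invariant under the grand-canonical evolution. -/
theorem expect_grandFlow_mul (s : Fin R → ℝ) (X Y : 𝔄) :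
    E.expect (E.grandFlow s X * E.grandFlow s Y) = E.expect (X * Y) := by
  rw [← grandFlow_mul]
  exact E.expect_grand s _

/-- The phase that a coupling operator acquires under the grand-canonical evolution. -/
def phase (μ : Idx R) (x : ℝ) : ℂ :=
  if μ.2 = 0 then Complex.exp (-(Complex.I * (E.chem μ.1 * x : ℝ)))
  else Complex.exp (Complex.I * (E.chem μ.1 * x : ℝ))

theorem contDiff_phase (μ : Idx R) : ContDiff ℝ 1 (E.phase μ) := by
  unfold phase
  split_ifs
  · exact ((contDiff_const.mul (Complex.ofRealCLM.contDiff.comp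
      (contDiff_const.mul contDiff_id))).neg).cexp
  · exact (contDiff_const.mul (Complex.ofRealCLM.contDiff.comp
      (contDiff_const.mul contDiff_id))).cexp

/-- On coupling operators the grand-canonical evolution is a time shift, up to a phase. -/
theorem grandFlow_op (s : Fin R → ℝ) (μ : Idx R) (r : ℝ) :
    E.grandFlow s (E.op μ r) = E.phase μ (s μ.1) • E.op μ (r + s μ.1) := by
  have key : ∀ α, E.grandFlow s (E.energyFlow (fun _ => r) (E.annih α (E.formFactor α))) =
      Complex.exp (Complex.I * (E.chem α * s α : ℝ)) •
        E.energyFlow (fun _ => r + s α) (E.annih α (E.formFactor α)) := by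
    intro α
    simp only [grandFlow, E.energyFlow_annih, E.numberFlow_annih, map_smul]
    rw [add_comm r, E.oneParticle_add]
    congr 2
    push_cast
    ring
  obtain ⟨α, i⟩ := μ
  fin_cases i
  · have := congrArg star (key α)
    rw [star_grandFlow, ← map_star (E.energyFlow fun _ => r), star_smul,
      ← map_star (E.energyFlow fun _ => r + s α)] at this
    simpa [op, couplingOp, phase, ← Complex.exp_conj] using this
  · simpa [op, couplingOp, phase] using key α

/-- The correlation function `Tr[B_μ(s) B_ν(r) ω_E]` with the two operators tilted in opposite
directions, as a function of `(λ, s, r)`. -/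
def crossCorrelation (μ ν : Idx R) (q : (Fin R → ℝ) × ℝ × ℝ) : ℂ :=
  E.expect (E.grandFlow (fun α => q.1 α / 2) (E.op μ q.2.1) *
    E.grandFlow (fun α => -(q.1 α / 2)) (E.op ν q.2.2))

theorem conj_correlation (μ ν : Idx R) (s r : ℝ) :
    conj (E.correlation μ ν s r) = E.correlation ν.bar μ.bar r s := by
  simp only [correlation, ← E.expect_star, star_mul, star_op]

/-- Conjugation exchanges the two operators, and hence the directions in which they are tilted. -/
theorem conj_crossCorrelation (μ ν : Idx R) (lam : Fin R → ℝ) (s r : ℝ) :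
    conj (E.crossCorrelation μ ν (lam, s, r)) =
      E.crossCorrelation ν.bar μ.bar (-lam, r, s) := by
  simp only [crossCorrelation, ← E.expect_star, star_mul, star_op, star_grandFlow, Pi.neg_apply,
    neg_div, neg_neg]

theorem crossCorrelation_eq (μ ν : Idx R) (q : (Fin R → ℝ) × ℝ × ℝ) :
    E.crossCorrelation μ ν q = E.phase μ (q.1 μ.1 / 2) * E.phase ν (-(q.1 ν.1 / 2)) *
      E.correlation μ ν (q.2.1 + q.1 μ.1 / 2) (q.2.2 + -(q.1 ν.1 / 2)) := by
  simp only [crossCorrelation, grandFlow_op, smul_mul_smul_comm, map_smul, smul_eq_mul, correlation]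

variable {E}

theorem contDiff_crossCorrelation
    (hE : ∀ μ ν, ContDiff ℝ 1 fun p : ℝ × ℝ => E.correlation μ ν p.1 p.2) (μ ν : Idx R) :
    ContDiff ℝ 1 (E.crossCorrelation μ ν) := by
  rw [funext (E.crossCorrelation_eq μ ν)]
  have hev : ∀ α : Fin R, ContDiff ℝ 1 fun q : (Fin R → ℝ) × ℝ × ℝ => q.1 α / 2 := fun α =>
    ((contDiff_apply ℝ ℝ α).comp contDiff_fst).div_const 2
  refine (((E.contDiff_phase μ).comp (hev μ.1)).mul
    ((E.contDiff_phase ν).comp (hev ν.1).neg)).mul ?_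
  exact (hE μ ν).comp (((contDiff_fst.comp contDiff_snd).add (hev μ.1)).prodMk
    ((contDiff_snd.comp contDiff_snd).add (hev ν.1).neg))

end Environment

variable {E : Environment ζ R 𝔥 𝔄} {t : ℝ}

theorem contourOrdered_eq (X Y : 𝔄) (z w : Contour t) :
    contourOrdered E X Y z w =
      orderWeight z w * E.expect (X * Y) + ζ.sign * orderWeight w z * E.expect (Y * X) := by
  obtain ⟨b, x⟩ := z
  obtain ⟨b', y⟩ := w
  cases b <;> cases b' <;> simp [contourOrdered, orderWeight]

/-- The change of the bare Green's function under the tilt, entrywise. Only the components that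
connect the two branches change, since `ω_E` commutes with the `Ω_α`. -/
def tiltShift (E : Environment ζ R 𝔥 𝔄) (t : ℝ)
    (p : (Fin R → ℝ) × (IndexedContour R t × IndexedContour R t)) : ℂ :=
  match p.2.1.1.1, p.2.2.1.1 with
  | .backward, .forward =>
      E.crossCorrelation p.2.1.1.2 p.2.2.1.2 (p.1, p.2.1.2, p.2.2.2) -
        E.crossCorrelation p.2.1.1.2 p.2.2.1.2 (0, p.2.1.2, p.2.2.2)
  | .forward, .backward =>
      ζ.sign * (E.crossCorrelation p.2.2.1.2 p.2.1.1.2 (p.1, p.2.2.2, p.2.1.2) -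
        E.crossCorrelation p.2.2.1.2 p.2.1.1.2 (0, p.2.2.2, p.2.1.2))
  | .forward, .forward => 0
  | .backward, .backward => 0

theorem tiltedGF_scalar (lam : Fin R → ℝ) (y w : IndexedContour R t) :
    (tiltedGF E t lam).scalar y w = (bareGF E t).scalar y w + tiltShift E t (lam, y, w) := by
  obtain ⟨⟨b, μ⟩, x⟩ := y
  obtain ⟨⟨b', ν⟩, x'⟩ := w
  cases b <;> cases b' <;>
    simp [Kernel.scalar, tiltedGF, bareGF, contourOrdered, tiltedOp, tiltShift,
      E.expect_grandFlow_mul,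
      Environment.crossCorrelation, mul_sub, IndexedContour.point]

/-- The derivative of `tiltShift` with respect to the tilt of reservoir `α`. -/
def tiltShiftDeriv (E : Environment ζ R 𝔥 𝔄) (t : ℝ) (α : Fin R)
    (p : ℝ × (IndexedContour R t × IndexedContour R t)) : ℂ :=
  match p.2.1.1.1, p.2.2.1.1 with
  | .backward, .forward =>
      fderiv ℝ (E.crossCorrelation p.2.1.1.2 p.2.2.1.2) (Pi.single α p.1, p.2.1.2, p.2.2.2)
        (Pi.single α 1, 0, 0)
  | .forward, .backward =>
      ζ.sign * fderiv ℝ (E.crossCorrelation p.2.2.1.2 p.2.1.1.2)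
        (Pi.single α p.1, p.2.2.2, p.2.1.2) (Pi.single α 1, 0, 0)
  | .forward, .forward => 0
  | .backward, .backward => 0

theorem continuous_tiltShift
    (hE : ∀ μ ν, ContDiff ℝ 1 fun p : ℝ × ℝ => E.correlation μ ν p.1 p.2) :
    Continuous (tiltShift E t) := by
  have hW := fun μ ν => (Environment.contDiff_crossCorrelation hE μ ν).continuous
  refine continuous_of_discrete ?_
  rintro ⟨b, μ⟩ ⟨b', ν⟩
  cases b <;> cases b' <;> simp only [tiltShift] <;> fun_prop

theorem continuous_tiltShiftDeriv
    (hE : ∀ μ ν, ContDiff ℝ 1 fun p : ℝ × ℝ => E.correlation μ ν p.1 p.2)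
    (α : Fin R) : Continuous (tiltShiftDeriv E t α) := by
  have hW := fun μ ν => (Environment.contDiff_crossCorrelation hE μ ν).continuous_fderiv one_ne_zero
  have hs : Continuous fun x : ℝ => (Pi.single α x : Fin R → ℝ) :=
    continuous_single (A := fun _ : Fin R => ℝ) α
  refine continuous_of_discrete ?_
  rintro ⟨b, μ⟩ ⟨b', ν⟩
  cases b <;> cases b' <;> simp only [tiltShiftDeriv] <;> fun_prop

theorem hasDerivAt_tiltShift
    (hE : ∀ μ ν, ContDiff ℝ 1 fun p : ℝ × ℝ => E.correlation μ ν p.1 p.2)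
    (α : Fin R) (x : ℝ) (p : IndexedContour R t × IndexedContour R t) :
    HasDerivAt (fun x : ℝ => tiltShift E t (Pi.single α x, p)) (tiltShiftDeriv E t α (x, p)) x := by
  have key : ∀ μ ν (s r : ℝ), HasDerivAt
      (fun x : ℝ => E.crossCorrelation μ ν (Pi.single α x, s, r))
      (fderiv ℝ (E.crossCorrelation μ ν) (Pi.single α x, s, r) (Pi.single α 1, 0, 0)) x := by
    intro μ ν s r
    have h1 := ((Environment.contDiff_crossCorrelation hE μ ν).differentiable
      one_ne_zero (Pi.single α x, s, r)).hasFDerivAt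
    have h2 : HasDerivAt (fun x : ℝ => ((Pi.single α x : Fin R → ℝ), s, r))
        (Pi.single α 1, 0, 0) x :=
      (hasDerivAt_single α x).prodMk (hasDerivAt_const x (s, r))
    exact h1.comp_hasDerivAt x h2
  obtain ⟨⟨⟨b, μ⟩, s⟩, ⟨⟨b', ν⟩, r⟩⟩ := p
  cases b <;> cases b' <;> simp only [tiltShift, tiltShiftDeriv]
  · exact hasDerivAt_const _ _
  · exact (key μ ν s r).sub_const _
  · exact ((key ν μ r s).sub_const _).const_mul _
  · exact hasDerivAt_const _ _

theorem isFredholmKernel_bareGF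
    (hE : ∀ μ ν, ContDiff ℝ 1 fun p : ℝ × ℝ => E.correlation μ ν p.1 p.2) :
    IsFredholmKernel (contourMeasure R t) (bareGF E t).scalar := by
  let κ := timeFamily t E.correlation fun μ ν => (hE μ ν).continuous
  have hκ : ∀ y w, (bareGF E t).scalar y w = orderWeight y.point w.point * κ (y, w) +
      ζ.sign * orderWeight w.point y.point * κ (w, y) := fun y w => contourOrdered_eq _ _ _ _
  have hζ : ‖ζ.sign‖ = 1 := by cases ζ <;> simp [Statistics.sign]
  refine ⟨fun w => ?_, ⟨‖κ‖ + ‖κ‖, fun y w => ?_⟩, fun w => ?_⟩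
  · simp only [hκ]
    have h1 := (measurable_orderWeight R t).comp (measurable_prodMk_right (y := w))
    have h2 := (measurable_orderWeight R t).comp (measurable_prodMk_left (x := w))
    have h3 : Continuous fun y => κ (y, w) := by fun_prop
    have h4 : Continuous fun y => κ (w, y) := by fun_prop
    exact (h1.mul h3.measurable).add ((h2.const_mul _).mul h4.measurable)
  · rw [hκ]
    refine (norm_add_le _ _).trans (add_le_add ?_ ?_)
    · rw [norm_mul]
      exact (mul_le_of_le_one_left (norm_nonneg _) (norm_orderWeight_le _ _)).trans
        (κ.norm_coe_le_norm _)
    · rw [norm_mul, norm_mul, hζ, one_mul]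
      exact (mul_le_of_le_one_left (norm_nonneg _) (norm_orderWeight_le _ _)).trans
        (κ.norm_coe_le_norm _)
  · filter_upwards [ae_time_ne w.2] with y hy
    have h3 : Continuous fun w => κ (y, w) := by fun_prop
    have h4 : Continuous fun w => κ (w, y) := by fun_prop
    have : ContinuousAt (fun w' => orderWeight y.point w.point * κ (y, w') +
      ζ.sign * orderWeight w.point y.point * κ (w', y)) w := by fun_prop
    refine this.congr ?_
    filter_upwards [eventually_orderWeight_eq hy] with w' hw'
    rw [hκ, hw'.1, hw'.2]

end Environment

/-! ### The self-energy -/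

section System

variable {ζ : Statistics} {R : ℕ} {𝔨 : Type*} [NormedAddCommGroup 𝔨] [InnerProductSpace ℂ 𝔨]
  {𝔖 : Type*} [Ring 𝔖] [StarRing 𝔖] [Algebra ℂ 𝔖] [StarModule ℂ 𝔖]
  (S : System ζ R 𝔨 𝔖)

namespace System

theorem algebraMap_commutator (μ ν : Idx R) (s r : ℝ) :
    algebraMap ℂ 𝔖 (S.commutator μ ν s r) = zetaComm ζ (S.op μ s) (S.op ν r) :=
  (S.exists_commutator μ ν s r).choose_spec.symm

theorem star_op (μ : Idx R) (s : ℝ) : star (S.op μ s) = S.op μ.bar s := by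
  obtain ⟨α, i⟩ := μ
  unfold op
  rw [← map_star]
  congr 1
  fin_cases i <;> simp [couplingOp, Idx.bar]

/-- The commutator functions are stationary: evolving both operators with `H_S` evolves their
commutator, which is a number and does not change. -/
theorem commutator_eq_sub [Nontrivial 𝔖] (μ ν : Idx R) (s r : ℝ) :
    S.commutator μ ν s r = S.commutator μ ν (s - r) 0 := by
  have hop : ∀ μ u, S.op μ (r + u) = S.flow r (S.op μ u) := fun μ u => S.flow_add r u _
  have h1 := hop μ (s - r)
  have h2 := hop ν 0
  rw [add_sub_cancel] at h1
  rw [add_zero] at h2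
  apply (algebraMap ℂ 𝔖).injective
  rw [algebraMap_commutator, h1, h2]
  have : zetaComm ζ (S.flow r (S.op μ (s - r))) (S.flow r (S.op ν 0)) =
      S.flow r (zetaComm ζ (S.op μ (s - r)) (S.op ν 0)) := by
    simp [zetaComm]
  rw [this, ← algebraMap_commutator, Algebra.algebraMap_eq_smul_one, map_smul, map_one]

theorem conj_commutator [Nontrivial 𝔖] (μ ν : Idx R) (s r : ℝ) :
    conj (S.commutator μ ν s r) = -(ζ.sign * S.commutator μ.bar ν.bar s r) := by
  apply (algebraMap ℂ 𝔖).injective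
  have h := congrArg star (S.algebraMap_commutator μ ν s r)
  rw [← algebraMap_star_comm] at h
  rw [map_neg, map_mul, algebraMap_commutator, ← Algebra.smul_def]
  refine h.trans ?_
  have hs : star ζ.sign = ζ.sign := ζ.conj_sign
  simp only [zetaComm, star_sub, star_mul, star_smul, star_op, smul_sub, smul_smul,
    ζ.sign_mul_self, hs, one_smul]
  abel

end System

variable {S} {t : ℝ}

/-- The step function in the self-energy, in the form that is the same on both branches. -/
theorem selfEnergy_apply (z w : Contour t) (μ ν : Idx R) :
    selfEnergy S t z w μ ν = match z.1, w.1 with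
      | .forward, .forward =>
          contourStep (.backward, z.2) (.backward, w.2) * S.commutator μ ν z.2 w.2
      | .backward, .backward =>
          -(contourStep (.backward, z.2) (.backward, w.2) * S.commutator μ ν z.2 w.2)
      | .forward, .backward => 0
      | .backward, .forward => 0 := by
  obtain ⟨b, x⟩ := z
  obtain ⟨b', y⟩ := w
  cases b <;> cases b'
  · simp [selfEnergy]
  · simp [selfEnergy, contourStep, Contour.precedes]
  · simp [selfEnergy, contourStep, Contour.precedes]
  · simp [selfEnergy, contourStep_forward, contourStep_backward, eq_comm]

theorem isBddMeas_selfEnergy [Nontrivial 𝔖]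
    (hS : ∀ μ ν, Continuous fun s : ℝ => S.commutator μ ν s 0) :
    IsBddMeas (Function.uncurry (selfEnergy S t).scalar) := by
  have hc : ∀ μ ν, Continuous fun p : ℝ × ℝ => S.commutator μ ν p.1 p.2 := fun μ ν =>
    ((hS μ ν).comp (by fun_prop : Continuous fun p : ℝ × ℝ => p.1 - p.2)).congr fun p =>
      (S.commutator_eq_sub μ ν p.1 p.2).symm
  constructor
  · refine measurable_of_discrete ?_
    rintro ⟨b, μ⟩ ⟨b', ν⟩
    have h1 := measurable_contourStep_same (t := t) .backward
    have h2 : Measurable fun q : Set.Icc (0 : ℝ) t × Set.Icc (0 : ℝ) t =>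
        S.commutator μ ν q.1 q.2 :=
      ((hc μ ν).comp (by fun_prop : Continuous fun q : Set.Icc (0 : ℝ) t × Set.Icc (0 : ℝ) t =>
          ((q.1 : ℝ), (q.2 : ℝ)))).measurable
    cases b <;> cases b' <;> simp only [Function.uncurry_apply_pair, Kernel.scalar,
      selfEnergy_apply, IndexedContour.point]
    · exact (h1.mul h2).neg
    · exact measurable_const
    · exact measurable_const
    · exact h1.mul h2
  · let κ := timeFamily t S.commutator hc
    refine ⟨‖κ‖, fun ⟨y, w⟩ => ?_⟩
    have h : ‖contourStep (t := t) (.backward, y.2) (.backward, w.2) *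
        S.commutator y.1.2 w.1.2 y.2 w.2‖ ≤ ‖κ‖ := by
      rw [norm_mul]
      exact (mul_le_of_le_one_left (norm_nonneg _) (norm_contourStep_le _ _)).trans
        (κ.norm_coe_le_norm (y, w))
    obtain ⟨⟨b, μ⟩, x⟩ := y
    obtain ⟨⟨b', ν⟩, x'⟩ := w
    cases b <;> cases b' <;> simp only [Function.uncurry_apply_pair, Kernel.scalar,
      selfEnergy_apply, IndexedContour.point,
      norm_neg, norm_zero] <;> first | exact h | exact norm_nonneg _

end System

/-! ### Matrix-valued contour integrals as scalar integrals -/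

/-- The orientation of a branch of the contour. -/
def Branch.orientation : Branch → ℂ
  | .backward => -1
  | .forward => 1

theorem Branch.orientation_mul_self (b : Branch) : b.orientation * b.orientation = 1 := by
  cases b <;> simp [Branch.orientation]

theorem Branch.sum_eq {M : Type*} [AddCommMonoid M] (f : Branch → M) :
    ∑ b, f b = f .backward + f .forward :=
  Finset.sum_pair (by decide)

section Scalar

variable {R : ℕ} {t : ℝ}

theorem contourIntegral_apply (f : Contour t → Matrix (Idx R) (Idx R) ℂ) (μ ν : Idx R) :
    contourIntegral f μ ν = ∑ b, b.orientation * ∫ τ, f (b, τ) μ ν ∂timeMeasure t := by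
  rw [Branch.sum_eq]
  simp only [contourIntegral, Matrix.of_apply, Branch.orientation]
  ring

theorem contourIntegral_add {f g : Contour t → Matrix (Idx R) (Idx R) ℂ}
    (hf : ∀ b μ ν, Integrable (fun τ => f (b, τ) μ ν) (timeMeasure t))
    (hg : ∀ b μ ν, Integrable (fun τ => g (b, τ) μ ν) (timeMeasure t)) :
    (contourIntegral fun x => f x + g x) = contourIntegral f + contourIntegral g := by
  ext μ ν
  simp only [contourIntegral_apply, Matrix.add_apply, ← Finset.sum_add_distrib, ← mul_add]
  exact Finset.sum_congr rfl fun b _ => by rw [integral_add (hf b μ ν) (hg b μ ν)]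

theorem IsBddMeas.slice {f : IndexedContour R t → ℂ} (hf : IsBddMeas f) (d : Branch × Idx R) :
    IsBddMeas fun τ => f (d, τ) :=
  ⟨hf.1.comp measurable_prodMk_left, hf.2.imp fun _ h _ => h _⟩

theorem integral_contourMeasure {f : IndexedContour R t → ℂ} (hf : IsBddMeas f) :
    ∫ y, f y ∂contourMeasure R t = ∑ b, ∑ μ, ∫ τ, f ((b, μ), τ) ∂timeMeasure t := by
  rw [contourMeasure, integral_prod _ (hf.integrable (contourMeasure R t)), integral_count,
    Fintype.sum_prod_type]

theorem Kernel.isRegular_iff (H : Kernel R t) :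
    H.IsRegular ↔ ∀ y : IndexedContour R t, IsBddMeas (H.scalar y) := by
  constructor
  · rintro ⟨h1, h2⟩ ⟨⟨b, μ⟩, τ⟩
    obtain ⟨M, hM⟩ := h2 (b, τ)
    exact ⟨measurable_from_prod_countable_right fun d => h1 (b, τ) d.1 μ d.2,
      M, fun w => hM w.point μ w.1.2⟩
  · intro h
    refine ⟨fun z b μ ν => ((h ((z.1, μ), z.2)).slice (b, ν)).1, fun z => ?_⟩
    choose M hM using fun μ : Idx R => (h ((z.1, μ), z.2)).2
    refine ⟨∑ μ, |M μ|, fun w μ ν => ?_⟩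
    exact (hM μ ((w.1, ν), w.2)).trans ((le_abs_self _).trans
      (Finset.single_le_sum (f := fun μ => |M μ|) (fun _ _ => abs_nonneg _) (Finset.mem_univ μ)))

theorem Kernel.scalar_injective : Function.Injective (Kernel.scalar (R := R) (t := t)) := by
  intro F F' h
  funext z w
  ext μ ν
  exact congrFun (congrFun h ((z.1, μ), z.2)) ((w.1, ν), w.2)

/-- A contour kernel with the orientations of the branches, which turn contour integrals into
integrals with respect to a positive measure. -/
def Kernel.oriented (F : Kernel R t) (y w : IndexedContour R t) : ℂ :=
  y.1.1.orientation * w.1.1.orientation * F.scalar y w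

theorem norm_orientation (b : Branch) : ‖b.orientation‖ = 1 := by
  cases b <;> simp [Branch.orientation]

theorem isBddMeas_oriented {F : Kernel R t} (hF : IsBddMeas (Function.uncurry F.scalar)) :
    IsBddMeas (Function.uncurry F.oriented) := by
  have h : Measurable fun y : IndexedContour R t => y.1.1.orientation :=
    (measurable_of_countable Branch.orientation).comp (measurable_fst.comp measurable_fst)
  obtain ⟨M, hM⟩ := hF.2
  refine ⟨((h.comp measurable_fst).mul (h.comp measurable_snd)).mul hF.1, M, fun ⟨y, w⟩ => ?_⟩
  change ‖y.1.1.orientation * w.1.1.orientation * F.scalar y w‖ ≤ M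
  rw [norm_mul, norm_mul, norm_orientation,
    norm_orientation, one_mul, one_mul]
  exact hM (y, w)

theorem IsBddMeas.uncurry_left {f : IndexedContour R t → IndexedContour R t → ℂ}
    (hf : IsBddMeas (Function.uncurry f)) (x : IndexedContour R t) : IsBddMeas (f x) :=
  ⟨hf.1.of_uncurry_left, hf.2.imp fun _ h y => h (x, y)⟩

variable {Sig F H : Kernel R t}

theorem isBddMeas_matrix_mul (hS : IsBddMeas (Function.uncurry Sig.scalar))
    (hF : ∀ w, IsBddMeas fun y => F.scalar y w)
    (A : Matrix (Idx R) (Idx R) ℂ) (x w : Contour t) (b : Branch) (μ σ κ ν : Idx R) :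
    IsBddMeas fun τ : Set.Icc (0 : ℝ) t => A μ σ * Sig x (b, τ) σ κ * F (b, τ) w κ ν := by
  exact ((isBddMeas_const (A μ σ)).mul ((hS.uncurry_left ((x.1, σ), x.2)).slice (b, κ))).mul
    ((hF ((w.1, ν), w.2)).slice (b, κ))

theorem integrable_matrix_mul (hS : IsBddMeas (Function.uncurry Sig.scalar))
    (hF : ∀ w, IsBddMeas fun y => F.scalar y w)
    (A : Matrix (Idx R) (Idx R) ℂ) (x w : Contour t) (b : Branch) (μ ν : Idx R) :
    Integrable (fun τ => (A * Sig x (b, τ) * F (b, τ) w) μ ν) (timeMeasure t) := by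
  simp only [Matrix.mul_apply, Finset.sum_mul]
  exact integrable_finsetSum _ fun κ _ => integrable_finsetSum _ fun σ _ =>
    (isBddMeas_matrix_mul hS hF A x w b μ σ κ ν).integrable _

/-- The inner contour integral in the matrix Dyson equation, for a constant left factor `A`.
`Kernel.oriented` carries the orientations at both of its arguments, so the one at `x` remains. -/
theorem contourIntegral_inner (hS : IsBddMeas (Function.uncurry Sig.scalar))
    (hF : ∀ w, IsBddMeas fun y => F.scalar y w)
    (A : Matrix (Idx R) (Idx R) ℂ) (x w : Contour t) (μ ν : Idx R) :
    (contourIntegral fun y => A * Sig x y * F y w) μ ν = ∑ σ, x.1.orientation * (A μ σ *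
      composeKernel (contourMeasure R t) Sig.oriented F.scalar ((x.1, σ), x.2)
        ((w.1, ν), w.2)) := by
  have h1 : ∀ σ, composeKernel (contourMeasure R t) Sig.oriented F.scalar ((x.1, σ), x.2)
      ((w.1, ν), w.2) = ∑ b, ∑ κ, ∫ τ, x.1.orientation * b.orientation * Sig x (b, τ) σ κ *
        F (b, τ) w κ ν ∂timeMeasure t := by
    intro σ
    exact integral_contourMeasure (((isBddMeas_oriented hS).uncurry_left _).mul (hF _))
  simp only [contourIntegral_apply, Matrix.mul_apply, Finset.sum_mul]
  have h2 : ∀ b, ∫ τ, ∑ κ, ∑ σ, A μ σ * Sig x (b, τ) σ κ * F (b, τ) w κ ν ∂timeMeasure t =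
      ∑ κ, ∑ σ, A μ σ * ∫ τ, Sig x (b, τ) σ κ * F (b, τ) w κ ν ∂timeMeasure t := by
    intro b
    rw [integral_finsetSum _ fun κ _ => integrable_finsetSum _ fun σ _ =>
      (isBddMeas_matrix_mul hS hF A x w b μ σ κ ν).integrable _]
    refine Finset.sum_congr rfl fun κ _ => ?_
    rw [integral_finsetSum _ fun σ _ =>
      (isBddMeas_matrix_mul hS hF A x w b μ σ κ ν).integrable _]
    refine Finset.sum_congr rfl fun σ _ => ?_
    simp only [mul_assoc]
    exact integral_const_mul _ _
  simp only [h1, h2]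
  simp only [Finset.mul_sum, mul_assoc, integral_const_mul]
  symm
  rw [Finset.sum_comm]
  refine Finset.sum_congr rfl fun b _ => ?_
  rw [Finset.sum_comm]
  refine Finset.sum_congr rfl fun κ _ => Finset.sum_congr rfl fun σ _ => ?_
  linear_combination (b.orientation * (A μ σ * ∫ τ, Sig x (b, τ) σ κ * F (b, τ) w κ ν
    ∂timeMeasure t)) * x.1.orientation_mul_self

theorem isBddMeas_compose (hS : IsBddMeas (Function.uncurry Sig.scalar))
    (hF : IsFredholmKernel (contourMeasure R t) F.scalar) (w : IndexedContour R t) :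
    IsBddMeas fun x => composeKernel (contourMeasure R t) Sig.oriented F.scalar x w :=
  have h := isBddMeas_oriented hS
  (hF.compose h.1 (h.2.imp fun _ h x y => h (x, y))).isBddMeas w

theorem integrable_contourIntegral (hS : IsBddMeas (Function.uncurry Sig.scalar))
    (hF : IsFredholmKernel (contourMeasure R t) F.scalar) (hH : H.IsRegular) (z w : Contour t)
    (b : Branch) (μ ν : Idx R) :
    Integrable (fun τ => (contourIntegral fun y => H z (b, τ) * Sig (b, τ) y * F y w) μ ν)
      (timeMeasure t) := by
  simp only [contourIntegral_inner hS hF.isBddMeas]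
  exact integrable_finsetSum _ fun σ _ => ((isBddMeas_const _).mul
    (((H.isRegular_iff.1 hH ((z.1, μ), z.2)).slice (b, σ)).mul
      ((isBddMeas_compose hS hF _).slice (b, σ)))).integrable _

/-- The double contour integral in the matrix Dyson equation is a scalar integral operator. -/
theorem contourIntegral_contourIntegral (hS : IsBddMeas (Function.uncurry Sig.scalar))
    (hF : IsFredholmKernel (contourMeasure R t) F.scalar) (hH : H.IsRegular)
    (y w : IndexedContour R t) :
    (contourIntegral fun x => contourIntegral fun x' =>
      H y.point x * Sig x x' * F x' w.point) y.1.2 w.1.2 =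
    applyKernel (contourMeasure R t)
      (composeKernel (contourMeasure R t) Sig.oriented F.scalar) (H.scalar y) w := by
  have hP := fun b σ => ((H.isRegular_iff.1 hH y).slice (b, σ)).mul
    ((isBddMeas_compose hS hF w).slice (b, σ))
  rw [applyKernel, integral_contourMeasure
    ((H.isRegular_iff.1 hH y).mul (isBddMeas_compose hS hF w)), contourIntegral_apply]
  refine Finset.sum_congr rfl fun b _ => ?_
  simp only [contourIntegral_inner hS hF.isBddMeas]
  change b.orientation * ∫ τ, ∑ σ, b.orientation * (H.scalar y ((b, σ), τ) *
    composeKernel (contourMeasure R t) Sig.oriented F.scalar ((b, σ), τ) w) ∂timeMeasure t = _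
  rw [integral_finsetSum _ fun σ _ => ((isBddMeas_const _).mul (hP b σ)).integrable _,
    Finset.mul_sum]
  refine Finset.sum_congr rfl fun σ _ => ?_
  rw [integral_const_mul, ← mul_assoc, b.orientation_mul_self, one_mul]

/-- The components of a double contour integral whose middle factor is diagonal in the branches
and odd under their exchange. -/
theorem contourIntegral_langreth
    (h0 : ∀ u v, Sig (.forward, u) (.backward, v) = 0 ∧ Sig (.backward, u) (.forward, v) = 0)
    (h1 : ∀ u v, Sig (.backward, u) (.backward, v) = -Sig (.forward, u) (.forward, v))
    (A B : Contour t → Matrix (Idx R) (Idx R) ℂ) :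
    (contourIntegral fun x => contourIntegral fun y => A x * Sig x y * B y) =
      (timeIntegral fun u => timeIntegral fun v =>
        A (.forward, u) * Sig.timeOrd u v * B (.forward, v)) -
      timeIntegral fun u => timeIntegral fun v =>
        A (.backward, u) * Sig.timeOrd u v * B (.backward, v) := by
  ext μ ν
  simp only [contourIntegral, timeIntegral, Matrix.of_apply, Matrix.sub_apply, h0, h1,
    Kernel.timeOrd, Matrix.mul_zero, Matrix.zero_mul, Matrix.zero_apply, integral_zero,
    Matrix.mul_neg, Matrix.neg_mul, Matrix.neg_apply, integral_neg, sub_zero, zero_sub, neg_neg]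

end Scalar

/-! ### The dressed Green's function near `λ = 0` -/

section Dressed

variable {ζ : Statistics} {R : ℕ} {𝔥 : Fin R → Type*}
  [∀ α, NormedAddCommGroup (𝔥 α)] [∀ α, InnerProductSpace ℂ (𝔥 α)]
  {𝔄 : Type*} [Ring 𝔄] [StarRing 𝔄] [Algebra ℂ 𝔄] [StarModule ℂ 𝔄]
  {𝔨 : Type*} [NormedAddCommGroup 𝔨] [InnerProductSpace ℂ 𝔨]
  {𝔖 : Type*} [Ring 𝔖] [Nontrivial 𝔖] [StarRing 𝔖] [Algebra ℂ 𝔖] [StarModule ℂ 𝔖]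
  {E : Environment ζ R 𝔥 𝔄} {S : System ζ R 𝔨 𝔖}

/-- The scalar Dyson equation that is satisfied by the rows of the Green's functions. -/
def dysonKernels (hE : ∀ μ ν, ContDiff ℝ 1 fun p : ℝ × ℝ => E.correlation μ ν p.1 p.2)
    (hS : ∀ μ ν, Continuous fun s : ℝ => S.commutator μ ν s 0) (t : ℝ) :
    DysonKernels (contourMeasure R t) where
  S := (selfEnergy S t).oriented
  K := (bareGF E t).scalar
  measurable_S := (isBddMeas_oriented (isBddMeas_selfEnergy hS)).1
  bounded_S := (isBddMeas_oriented (isBddMeas_selfEnergy hS)).2.imp fun _ h x y => h (x, y)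
  isFredholmKernel_K := isFredholmKernel_bareGF hE

/-- The tilt of the bare Green's function as a continuous family of continuous kernels. -/
def tiltFamily (hE : ∀ μ ν, ContDiff ℝ 1 fun p : ℝ × ℝ => E.correlation μ ν p.1 p.2) (t : ℝ) :
    C(Fin R → ℝ, C(IndexedContour R t × IndexedContour R t, ℂ)) :=
  ContinuousMap.curry ⟨tiltShift E t, continuous_tiltShift hE⟩

/-- The derivative of `tiltFamily` at `λ = 0` in the direction of reservoir `α`. -/
def tiltFamilyDeriv (hE : ∀ μ ν, ContDiff ℝ 1 fun p : ℝ × ℝ => E.correlation μ ν p.1 p.2) (t : ℝ)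
    (α : Fin R) : C(IndexedContour R t × IndexedContour R t, ℂ) :=
  ContinuousMap.curry ⟨tiltShiftDeriv E t α, continuous_tiltShiftDeriv hE α⟩ 0

variable {t : ℝ}

theorem tiltFamily_zero
    (hE : ∀ μ ν, ContDiff ℝ 1 fun p : ℝ × ℝ => E.correlation μ ν p.1 p.2) :
    tiltFamily hE t 0 = 0 := by
  refine ContinuousMap.ext fun ⟨⟨⟨b, μ⟩, s⟩, ⟨⟨b', ν⟩, r⟩⟩ => ?_
  change tiltShift E t (0, _) = 0
  cases b <;> cases b' <;> simp [tiltShift]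

theorem hasDerivAt_tiltFamily
    (hE : ∀ μ ν, ContDiff ℝ 1 fun p : ℝ × ℝ => E.correlation μ ν p.1 p.2)
    (α : Fin R) :
    HasDerivAt (fun x : ℝ => tiltFamily hE t (Pi.single α x)) (tiltFamilyDeriv hE t α) 0 := by
  have hc : Continuous fun p : ℝ × (IndexedContour R t × IndexedContour R t) =>
      tiltShift E t (Pi.single α p.1, p.2) :=
    (continuous_tiltShift hE).comp
      (((continuous_single (A := fun _ : Fin R => ℝ) α).comp continuous_fst).prodMk continuous_snd)
  exact hasDerivAt_curry ⟨_, hc⟩ ⟨tiltShiftDeriv E t α, continuous_tiltShiftDeriv hE α⟩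
    (fun x p => hasDerivAt_tiltShift hE α x p) 0

theorem bareGF_eq_tiltedGF_zero : bareGF E t = tiltedGF E t 0 := by
  apply Kernel.scalar_injective
  funext y w
  have h : tiltShift E t (0, y, w) = 0 := by
    obtain ⟨⟨b, μ⟩, s⟩ := y
    obtain ⟨⟨b', ν⟩, r⟩ := w
    cases b <;> cases b' <;> simp [tiltShift]
  rw [tiltedGF_scalar, h, add_zero]

theorem isFredholmKernel_tiltedGF
    (hE : ∀ μ ν, ContDiff ℝ 1 fun p : ℝ × ℝ => E.correlation μ ν p.1 p.2)
    (lam : Fin R → ℝ) :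
    IsFredholmKernel (contourMeasure R t) (tiltedGF E t lam).scalar := by
  have h : (tiltedGF E t lam).scalar = fun y w => (bareGF E t).scalar y w +
      tiltFamily hE t lam (y, w) := funext fun y => funext fun w => tiltedGF_scalar lam y w
  rw [h]
  exact (isFredholmKernel_bareGF hE).add (isFredholmKernel_of_continuous _)

/-- The matrix Dyson equation for the tilted Green's function is equivalent to a scalar equation for
each row, whose bare kernel is a continuous perturbation of the untilted one. -/
theorem isDressed_iff
    (hE : ∀ μ ν, ContDiff ℝ 1 fun p : ℝ × ℝ => E.correlation μ ν p.1 p.2)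
    (hS : ∀ μ ν, Continuous fun s : ℝ => S.commutator μ ν s 0)
    (lam : Fin R → ℝ) (H : Kernel R t) :
    IsDressed (tiltedGF E t lam) (selfEnergy S t) H ↔
      ∀ y, (dysonKernels hE hS t).SolvesRow (tiltFamily hE t lam) y (H.scalar y) := by
  have hK : (tiltedGF E t lam).scalar = fun y w => (bareGF E t).scalar y w +
      tiltFamily hE t lam (y, w) := funext fun y => funext fun w => tiltedGF_scalar lam y w
  have key : H.IsRegular → ∀ y w : IndexedContour R t,
      ((tiltedGF E t lam y.point w.point + contourIntegral fun x => contourIntegral fun x' =>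
        H y.point x * selfEnergy S t x x' * tiltedGF E t lam x' w.point) y.1.2 w.1.2 =
      (bareGF E t).scalar y w + tiltFamily hE t lam (y, w) + applyKernel (contourMeasure R t)
        (composeKernel (contourMeasure R t) (dysonKernels hE hS t).S fun y w =>
          (bareGF E t).scalar y w + tiltFamily hE t lam (y, w)) (H.scalar y) w) := by
    intro hH y w
    rw [Matrix.add_apply, contourIntegral_contourIntegral (isBddMeas_selfEnergy hS)
      (isFredholmKernel_tiltedGF hE lam) hH, hK]
    exact congrArg (· + _) (congrFun (congrFun hK y) w)
  constructor
  · rintro ⟨hH, h⟩ y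
    refine ⟨H.isRegular_iff.1 hH y, fun w => ?_⟩
    refine Eq.trans ?_ (key hH y w)
    exact congrFun (congrFun (h y.point w.point) y.1.2) w.1.2
  · intro h
    have hH := H.isRegular_iff.2 fun y => (h y).1
    refine ⟨hH, fun z w => ?_⟩
    ext μ ν
    exact ((h ((z.1, μ), z.2)).2 ((w.1, ν), w.2)).trans
      (key hH ((z.1, μ), z.2) ((w.1, ν), w.2)).symm

variable {G : Kernel R t}

theorem solvesRow_zero
    (hE : ∀ μ ν, ContDiff ℝ 1 fun p : ℝ × ℝ => E.correlation μ ν p.1 p.2)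
    (hS : ∀ μ ν, Continuous fun s : ℝ => S.commutator μ ν s 0)
    (hG : IsDressed (bareGF E t) (selfEnergy S t) G) (y : IndexedContour R t) :
    (dysonKernels hE hS t).SolvesRow 0 y (G.scalar y) := by
  rw [bareGF_eq_tiltedGF_zero] at hG
  have := (isDressed_iff hE hS 0 G).1 hG y
  rwa [tiltFamily_zero] at this

/-- The kernel with given scalar form. -/
def Kernel.ofScalar (f : IndexedContour R t → IndexedContour R t → ℂ) : Kernel R t :=
  fun z w => Matrix.of fun μ ν => f ((z.1, μ), z.2) ((w.1, ν), w.2)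

/-- If the untilted Dyson equation has a unique solution `G`, then the homogeneous equation has
only the trivial solution: any other one could be added to the rows of `G`. -/
theorem eq_zero_of_op_eq
    (hE : ∀ μ ν, ContDiff ℝ 1 fun p : ℝ × ℝ => E.correlation μ ν p.1 p.2)
    (hS : ∀ μ ν, Continuous fun s : ℝ => S.commutator μ ν s 0)
    (hG : IsDressed (bareGF E t) (selfEnergy S t) G)
    (hG_unique : ∀ G', IsDressed (bareGF E t) (selfEnergy S t) G' → G' = G)
    (k : C(IndexedContour R t, ℂ)) (hk : (dysonKernels hE hS t).op k = k) : k = 0 := by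
  have h : IsDressed (bareGF E t) (selfEnergy S t)
      (Kernel.ofScalar fun y w => G.scalar y w + k w) := by
    rw [bareGF_eq_tiltedGF_zero, isDressed_iff hE hS, tiltFamily_zero]
    intro y
    refine (DysonKernels.solvesRow_iff (solvesRow_zero hE hS hG y) 0 _).2 ⟨k, ?_, fun w => rfl⟩
    rw [sub_apply, sub_apply, one_apply_eq_self, hk, sub_self, map_zero, map_zero, zero_apply,
      sub_zero]
  refine ContinuousMap.ext fun w => ?_
  have h1 := congrArg (fun F : Kernel R t => F.scalar w w) (hG_unique _ h)
  exact add_eq_left.1 h1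

theorem isUnit_one_sub_op
    (hE : ∀ μ ν, ContDiff ℝ 1 fun p : ℝ × ℝ => E.correlation μ ν p.1 p.2)
    (hS : ∀ μ ν, Continuous fun s : ℝ => S.commutator μ ν s 0)
    (hG : IsDressed (bareGF E t) (selfEnergy S t) G)
    (hG_unique : ∀ G', IsDressed (bareGF E t) (selfEnergy S t) G' → G' = G) :
    IsUnit (1 - (dysonKernels hE hS t).op) :=
  IsFredholmKernel.isUnit_one_sub_op _ (eq_zero_of_op_eq hE hS hG hG_unique)

theorem eventually_isDressed_iff
    (hE : ∀ μ ν, ContDiff ℝ 1 fun p : ℝ × ℝ => E.correlation μ ν p.1 p.2)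
    (hS : ∀ μ ν, Continuous fun s : ℝ => S.commutator μ ν s 0)
    (hG : IsDressed (bareGF E t) (selfEnergy S t) G)
    (hG_unique : ∀ G', IsDressed (bareGF E t) (selfEnergy S t) G' → G' = G) :
    ∀ᶠ lam in 𝓝 (0 : Fin R → ℝ), ∀ H,
      IsDressed (tiltedGF E t lam) (selfEnergy S t) H ↔ ∀ y w, H.scalar y w = G.scalar y w +
        (dysonKernels hE hS t).correction y (G.isRegular_iff.1 hG.1 y) (tiltFamily hE t lam) w := by
  have h1 := DysonKernels.eventually_isUnit (isUnit_one_sub_op hE hS hG hG_unique)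
  have h2 : Tendsto (tiltFamily hE t) (𝓝 0) (𝓝 0) := by
    have := (tiltFamily hE t).continuous.tendsto 0
    rwa [tiltFamily_zero] at this
  filter_upwards [h2.eventually h1] with lam hlam H
  rw [isDressed_iff hE hS]
  exact forall_congr' fun y =>
    DysonKernels.solvesRow_iff_of_isUnit (solvesRow_zero hE hS hG y) hlam _

theorem eventually_existsUnique
    (hE : ∀ μ ν, ContDiff ℝ 1 fun p : ℝ × ℝ => E.correlation μ ν p.1 p.2)
    (hS : ∀ μ ν, Continuous fun s : ℝ => S.commutator μ ν s 0)
    (hG : IsDressed (bareGF E t) (selfEnergy S t) G)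
    (hG_unique : ∀ G', IsDressed (bareGF E t) (selfEnergy S t) G' → G' = G) :
    ∀ᶠ lam in 𝓝 (0 : Fin R → ℝ), ∃! H, IsDressed (tiltedGF E t lam) (selfEnergy S t) H := by
  filter_upwards [eventually_isDressed_iff hE hS hG hG_unique] with lam h
  refine ⟨Kernel.ofScalar fun y w => G.scalar y w + (dysonKernels hE hS t).correction y
    (G.isRegular_iff.1 hG.1 y) (tiltFamily hE t lam) w, (h _).2 fun y w => rfl, fun H hH => ?_⟩
  exact Kernel.scalar_injective (funext fun y => funext fun w => (h H).1 hH y w)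

/-- The tilted dressed Green's functions are differentiable at `λ = 0`, and the derivatives solve
the linearized Dyson equation. -/
theorem exists_hasDerivAt_dressed
    (hE : ∀ μ ν, ContDiff ℝ 1 fun p : ℝ × ℝ => E.correlation μ ν p.1 p.2)
    (hS : ∀ μ ν, Continuous fun s : ℝ => S.commutator μ ν s 0)
    (hG : IsDressed (bareGF E t) (selfEnergy S t) G)
    (hG_unique : ∀ G', IsDressed (bareGF E t) (selfEnergy S t) G' → G' = G)
    {Gt : (Fin R → ℝ) → Kernel R t}
    (hGt : ∀ᶠ lam in 𝓝 (0 : Fin R → ℝ), IsDressed (tiltedGF E t lam) (selfEnergy S t) (Gt lam))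
    (α : Fin R) (y : IndexedContour R t) : ∃ k : C(IndexedContour R t, ℂ),
      (∀ w, HasDerivAt (fun x : ℝ => (Gt (Pi.single α x)).scalar y w) (k w) 0) ∧
      k = (dysonKernels hE hS t).op k + (dysonKernels hE hS t).forcing y
        (G.isRegular_iff.1 hG.1 y) (tiltFamilyDeriv hE t α) := by
  have h0 : tiltFamily hE t (Pi.single α 0) = 0 := by rw [Pi.single_zero, tiltFamily_zero]
  obtain ⟨k, hk, hk'⟩ := DysonKernels.hasDerivAt_correction
    (isUnit_one_sub_op hE hS hG hG_unique) y (G.isRegular_iff.1 hG.1 y) h0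
    (hasDerivAt_tiltFamily hE α)
  refine ⟨k, fun w => ?_, hk'⟩
  have h1 : HasDerivAt (fun x : ℝ => (dysonKernels hE hS t).correction y
      (G.isRegular_iff.1 hG.1 y) (tiltFamily hE t (Pi.single α x)) w) (k w) 0 :=
    (ContinuousMap.evalCLM (M := ℂ) ℝ w).hasFDerivAt.comp_hasDerivAt (0 : ℝ) hk
  refine (h1.const_add (G.scalar y w)).congr_of_eventuallyEq ?_
  have h2 : Tendsto (fun x : ℝ => (Pi.single α x : Fin R → ℝ)) (𝓝 0) (𝓝 0) := by
    have := (continuous_single (A := fun _ : Fin R => ℝ) α).tendsto 0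
    rwa [Pi.single_zero] at this
  filter_upwards [h2.eventually (eventually_isDressed_iff hE hS hG hG_unique),
    h2.eventually hGt] with x hx hx'
  exact (hx _).1 hx' y w

theorem hasDerivAt_tiltedGF
    (hE : ∀ μ ν, ContDiff ℝ 1 fun p : ℝ × ℝ => E.correlation μ ν p.1 p.2)
    (α : Fin R) (y w : IndexedContour R t) :
    HasDerivAt (fun x : ℝ => (tiltedGF E t (Pi.single α x)).scalar y w)
      (tiltFamilyDeriv hE t α (y, w)) 0 := by
  simp only [tiltedGF_scalar]
  exact (hasDerivAt_tiltShift hE α 0 (y, w)).const_add _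

end Dressed

/-! ### Effective conjugation -/

/-- The branch in the other direction. -/
def Branch.flip : Branch → Branch
  | .backward => .forward
  | .forward => .backward

/-- The point of the other branch at the same time. -/
def Contour.flip {t : ℝ} (z : Contour t) : Contour t := (z.1.flip, z.2)

/-- Effective conjugation of a contour kernel, together with the exchange of the branches. -/
def Kernel.star {R : ℕ} {t : ℝ} (ζ : Statistics) (F : Kernel R t) : Kernel R t :=
  fun z w => effConj ζ (F z.flip w.flip)

/-- The exchange of the branches reverses the orientation of the contour. -/
theorem contourIntegral_flip {R : ℕ} {t : ℝ} (ζ : Statistics)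
    (f : Contour t → Matrix (Idx R) (Idx R) ℂ) :
    (contourIntegral fun x => effConj ζ (f x.flip)) = -effConj ζ (contourIntegral f) := by
  ext μ ν
  simp only [contourIntegral, Contour.flip, Branch.flip, effConj_apply, Matrix.of_apply,
    Matrix.neg_apply, integral_const_mul, integral_conj, map_sub]
  ring

theorem Kernel.IsRegular.star {R : ℕ} {t : ℝ} {F : Kernel R t} (hF : F.IsRegular)
    (ζ : Statistics) : (F.star ζ).IsRegular := by
  refine ⟨fun z b μ ν => ?_, fun z => ?_⟩
  · simp only [Kernel.star, effConj_apply]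
    exact (Complex.continuous_conj.measurable.comp
      (hF.1 z.flip b.flip μ.bar ν.bar)).const_mul _
  · obtain ⟨M, hM⟩ := hF.2 z.flip
    have hζ : ‖ζ.sign‖ = 1 := by cases ζ <;> simp [Statistics.sign]
    refine ⟨M, fun w μ ν => ?_⟩
    rw [Kernel.star, effConj_apply, norm_mul, hζ, one_mul, RCLike.norm_conj]
    exact hM _ _ _

/-- The two orientation signs from the two contour integrals cancel. -/
theorem IsDressed.star {R : ℕ} {t : ℝ} {C Sig G : Kernel R t} (hG : IsDressed C Sig G)
    (ζ : Statistics) : IsDressed (C.star ζ) (Sig.star ζ) (G.star ζ) := by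
  refine ⟨hG.1.star ζ, fun z w => ?_⟩
  simp only [Kernel.star, ← effConj_mul_mul]
  have h1 : ∀ x : Contour t, (contourIntegral fun y => effConj ζ
      (G z.flip x.flip * Sig x.flip y.flip * C y.flip w.flip)) =
      effConj ζ (-contourIntegral fun y => G z.flip x.flip * Sig x.flip y * C y w.flip) := by
    intro x
    rw [effConj_neg]
    exact contourIntegral_flip ζ fun y => G z.flip x.flip * Sig x.flip y * C y w.flip
  simp only [h1]
  rw [contourIntegral_flip ζ fun x =>
    -contourIntegral fun y => G z.flip x * Sig x y * C y w.flip, ← effConj_neg, hG.2,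
    effConj_add]
  congr 2
  ext μ ν
  simp only [contourIntegral, Matrix.of_apply, Matrix.neg_apply, integral_neg]
  ring

theorem conj_contourStep {t : ℝ} (z w : Contour t) :
    conj (contourStep z w) = contourStep z w := by
  unfold contourStep
  split_ifs <;> simp [Complex.conj_ofNat]

/-- The self-energy is invariant: the exchange of the branches changes its sign, and so does the
conjugation of the commutator. -/
theorem star_selfEnergy {ζ : Statistics} {R : ℕ} {𝔨 : Type*} [NormedAddCommGroup 𝔨]
    [InnerProductSpace ℂ 𝔨] {𝔖 : Type*} [Ring 𝔖] [Nontrivial 𝔖] [StarRing 𝔖] [Algebra ℂ 𝔖]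
    [StarModule ℂ 𝔖] (S : System ζ R 𝔨 𝔖) (t : ℝ) :
    (selfEnergy S t).star ζ = selfEnergy S t := by
  have key : ∀ μ ν (s r : ℝ), ζ.sign * conj (S.commutator μ.bar ν.bar s r) =
      -S.commutator μ ν s r := by
    intro μ ν s r
    rw [S.conj_commutator, Idx.bar_bar, Idx.bar_bar]
    linear_combination -S.commutator μ ν s r * ζ.sign_mul_self
  funext ⟨b, x⟩ ⟨b', y⟩
  ext μ ν
  cases b <;> cases b' <;> simp only [Kernel.star, effConj_apply, Contour.flip, Branch.flip,
    selfEnergy_apply, map_mul, map_neg, map_zero, mul_zero, conj_contourStep]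
  · linear_combination contourStep (t := t) (.backward, x) (.backward, y) * key μ ν x y
  · linear_combination -contourStep (t := t) (.backward, x) (.backward, y) * key μ ν x y

/-- The exchange of the branches reverses the tilt. -/
theorem star_tiltedGF {ζ : Statistics} {R : ℕ} {𝔥 : Fin R → Type*}
    [∀ α, NormedAddCommGroup (𝔥 α)] [∀ α, InnerProductSpace ℂ (𝔥 α)]
    {𝔄 : Type*} [Ring 𝔄] [StarRing 𝔄] [Algebra ℂ 𝔄] [StarModule ℂ 𝔄]
    (E : Environment ζ R 𝔥 𝔄) (t : ℝ) (lam : Fin R → ℝ) :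
    (tiltedGF E t lam).star ζ = tiltedGF E t (-lam) := by
  have hflip : ∀ x y : Set.Icc (0 : ℝ) t, contourStep (.forward, x) (.forward, y) =
      contourStep (.backward, y) (.backward, x) := by
    intro x y
    simp [contourStep_forward, contourStep_backward, eq_comm]
  funext ⟨b, x⟩ ⟨b', y⟩
  ext μ ν
  have h1 := E.conj_crossCorrelation μ.bar ν.bar lam x y
  have h2 := E.conj_crossCorrelation ν.bar μ.bar lam y x
  have h3 := E.conj_correlation μ.bar ν.bar x y
  have h4 := E.conj_correlation ν.bar μ.bar y x
  simp only [Idx.bar_bar, Environment.crossCorrelation, Environment.correlation] at h1 h2 h3 h4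
  cases b <;> cases b' <;> simp only [Kernel.star, effConj_apply, Contour.flip, Branch.flip,
    tiltedGF, Matrix.of_apply, contourOrdered, tiltedOp, E.expect_grandFlow_mul, map_add, map_mul,
    conj_contourStep, ζ.conj_sign, h3, h4, hflip]
  · linear_combination contourStep (t := t) (.backward, x) (.backward, y) *
      E.expect (E.op μ x * E.op ν y) * ζ.sign_mul_self
  · rw [h2, ← mul_assoc, ζ.sign_mul_self, one_mul]
  · rw [h1]
  · linear_combination contourStep (t := t) (.backward, y) (.backward, x) *
      E.expect (E.op μ x * E.op ν y) * ζ.sign_mul_self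

/-! ### The dressed heat kernel -/

theorem heatKernel_scalar {R : ℕ} {t : ℝ} {F : (Fin R → ℝ) → Kernel R t} {α : Fin R}
    {y w : IndexedContour R t} {d : ℂ}
    (h : HasDerivAt (fun x : ℝ => (F (Pi.single α x)).scalar y w) d 0) :
    (heatKernel F α).scalar y w = Complex.I * d :=
  congrArg (Complex.I * ·) h.deriv

section HeatKernel

variable {ζ : Statistics} {R : ℕ} {𝔥 : Fin R → Type*}
  [∀ α, NormedAddCommGroup (𝔥 α)] [∀ α, InnerProductSpace ℂ (𝔥 α)]
  {𝔄 : Type*} [Ring 𝔄] [StarRing 𝔄] [Algebra ℂ 𝔄] [StarModule ℂ 𝔄]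
  {𝔨 : Type*} [NormedAddCommGroup 𝔨] [InnerProductSpace ℂ 𝔨]
  {𝔖 : Type*} [Ring 𝔖] [Nontrivial 𝔖] [StarRing 𝔖] [Algebra ℂ 𝔖] [StarModule ℂ 𝔖]
  {E : Environment ζ R 𝔥 𝔄} {S : System ζ R 𝔨 𝔖} {t : ℝ} {G : Kernel R t}
  {Gt : (Fin R → ℝ) → Kernel R t}

theorem heatKernel_tiltedGF_scalar
    (hE : ∀ μ ν, ContDiff ℝ 1 fun p : ℝ × ℝ => E.correlation μ ν p.1 p.2) (α : Fin R) :
    (heatKernel (tiltedGF E t) α).scalar =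
      fun y w => Complex.I * tiltFamilyDeriv hE t α (y, w) :=
  funext fun y => funext fun w => heatKernel_scalar (hasDerivAt_tiltedGF hE α y w)

theorem isFredholmKernel_heatKernel_tiltedGF
    (hE : ∀ μ ν, ContDiff ℝ 1 fun p : ℝ × ℝ => E.correlation μ ν p.1 p.2) (α : Fin R) :
    IsFredholmKernel (contourMeasure R t) (heatKernel (tiltedGF E t) α).scalar := by
  rw [heatKernel_tiltedGF_scalar hE]
  exact isFredholmKernel_of_continuous (Complex.I • tiltFamilyDeriv hE t α)

theorem isRegular_heatKernel_tiltedGF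
    (hE : ∀ μ ν, ContDiff ℝ 1 fun p : ℝ × ℝ => E.correlation μ ν p.1 p.2) (α : Fin R) :
    (heatKernel (tiltedGF E t) α).IsRegular := by
  rw [Kernel.isRegular_iff, heatKernel_tiltedGF_scalar hE]
  intro y
  exact isBddMeas_of_continuous
    ⟨fun w => Complex.I * tiltFamilyDeriv hE t α (y, w), by fun_prop⟩

/-- On a single branch the bare heat kernel vanishes. -/
theorem heatKernel_tiltedGF_same
    (hE : ∀ μ ν, ContDiff ℝ 1 fun p : ℝ × ℝ => E.correlation μ ν p.1 p.2) (α : Fin R)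
    (b : Branch) (x y : Set.Icc (0 : ℝ) t) :
    heatKernel (tiltedGF E t) α (b, x) (b, y) = 0 := by
  ext μ ν
  refine (congrFun (congrFun (heatKernel_tiltedGF_scalar hE α) ((b, μ), x)) ((b, ν), y)).trans ?_
  change Complex.I * tiltShiftDeriv E t α (0, _) = 0
  cases b <;> simp [tiltShiftDeriv]

theorem isRegular_heatKernel_dressed
    (hE : ∀ μ ν, ContDiff ℝ 1 fun p : ℝ × ℝ => E.correlation μ ν p.1 p.2)
    (hS : ∀ μ ν, Continuous fun s : ℝ => S.commutator μ ν s 0)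
    (hG : IsDressed (bareGF E t) (selfEnergy S t) G)
    (hG_unique : ∀ G', IsDressed (bareGF E t) (selfEnergy S t) G' → G' = G)
    (hGt : ∀ᶠ lam in 𝓝 (0 : Fin R → ℝ), IsDressed (tiltedGF E t lam) (selfEnergy S t) (Gt lam))
    (α : Fin R) : (heatKernel Gt α).IsRegular := by
  rw [Kernel.isRegular_iff]
  intro y
  obtain ⟨k, hk, -⟩ := exists_hasDerivAt_dressed hE hS hG hG_unique hGt α y
  rw [show (heatKernel Gt α).scalar y = fun w => Complex.I * k w from
    funext fun w => heatKernel_scalar (hk w)]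
  exact isBddMeas_of_continuous (Complex.I • k)

theorem heatKernel_dressed_scalar_eq
    (hE : ∀ μ ν, ContDiff ℝ 1 fun p : ℝ × ℝ => E.correlation μ ν p.1 p.2)
    (hS : ∀ μ ν, Continuous fun s : ℝ => S.commutator μ ν s 0)
    (hG : IsDressed (bareGF E t) (selfEnergy S t) G)
    (hG_unique : ∀ G', IsDressed (bareGF E t) (selfEnergy S t) G' → G' = G)
    (hGt : ∀ᶠ lam in 𝓝 (0 : Fin R → ℝ), IsDressed (tiltedGF E t lam) (selfEnergy S t) (Gt lam))
    (α : Fin R) (y w : IndexedContour R t) :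
    (heatKernel Gt α).scalar y w = (heatKernel (tiltedGF E t) α).scalar y w +
      applyKernel (contourMeasure R t) (composeKernel (contourMeasure R t)
        (selfEnergy S t).oriented (heatKernel (tiltedGF E t) α).scalar) (G.scalar y) w +
      applyKernel (contourMeasure R t) (composeKernel (contourMeasure R t)
        (selfEnergy S t).oriented (bareGF E t).scalar) ((heatKernel Gt α).scalar y) w := by
  obtain ⟨k, hk, hk'⟩ := exists_hasDerivAt_dressed hE hS hG hG_unique hGt α y
  have hg : (heatKernel Gt α).scalar y = fun w => Complex.I * k w :=
    funext fun w => heatKernel_scalar (hk w)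
  have h1 := (dysonKernels hE hS t).applyKernel_compose_smul Complex.I
    (fun y w => tiltFamilyDeriv hE t α (y, w)) (G.scalar y) w
  have h2 := DFunLike.congr_fun hk' w
  rw [ContinuousMap.add_apply, DysonKernels.forcing_apply] at h2
  rw [heatKernel_tiltedGF_scalar hE, hg, applyKernel_smul]
  refine (congrArg (Complex.I * ·) h2).trans ?_
  refine Eq.trans ?_ (congrArg (fun a => _ + a + _) h1.symm)
  change Complex.I * (applyKernel (contourMeasure R t) (composeKernel (contourMeasure R t)
        (selfEnergy S t).oriented (bareGF E t).scalar) k w + _) = _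
  ring

/-- The linearized Dyson equation, with its two integral terms apart. -/
theorem heatKernel_dressed_eq
    (hE : ∀ μ ν, ContDiff ℝ 1 fun p : ℝ × ℝ => E.correlation μ ν p.1 p.2)
    (hS : ∀ μ ν, Continuous fun s : ℝ => S.commutator μ ν s 0)
    (hG : IsDressed (bareGF E t) (selfEnergy S t) G)
    (hG_unique : ∀ G', IsDressed (bareGF E t) (selfEnergy S t) G' → G' = G)
    (hGt : ∀ᶠ lam in 𝓝 (0 : Fin R → ℝ), IsDressed (tiltedGF E t lam) (selfEnergy S t) (Gt lam))
    (α : Fin R) (z w : Contour t) :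
    heatKernel Gt α z w = heatKernel (tiltedGF E t) α z w +
      (contourIntegral fun x => contourIntegral fun y =>
        G z x * selfEnergy S t x y * heatKernel (tiltedGF E t) α y w) +
      contourIntegral fun x => contourIntegral fun y =>
        heatKernel Gt α z x * selfEnergy S t x y * bareGF E t y w := by
  have hg := isRegular_heatKernel_dressed hE hS hG hG_unique hGt α
  have hSig := isBddMeas_selfEnergy (t := t) hS
  ext μ ν
  let y₀ : IndexedContour R t := ((z.1, μ), z.2)
  let w₀ : IndexedContour R t := ((w.1, ν), w.2)
  have h1 := contourIntegral_contourIntegral hSig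
    (isFredholmKernel_heatKernel_tiltedGF hE α) hG.1 y₀ w₀
  have h2 := contourIntegral_contourIntegral hSig (isFredholmKernel_bareGF hE) hg y₀ w₀
  rw [Matrix.add_apply, Matrix.add_apply]
  refine (heatKernel_dressed_scalar_eq hE hS hG hG_unique hGt α y₀ w₀).trans ?_
  rw [← h1, ← h2]
  rfl

/-- The linearized Dyson equation on the contour. -/
theorem heatKernel_dressed_eq_contourIntegral
    (hE : ∀ μ ν, ContDiff ℝ 1 fun p : ℝ × ℝ => E.correlation μ ν p.1 p.2)
    (hS : ∀ μ ν, Continuous fun s : ℝ => S.commutator μ ν s 0)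
    (hG : IsDressed (bareGF E t) (selfEnergy S t) G)
    (hG_unique : ∀ G', IsDressed (bareGF E t) (selfEnergy S t) G' → G' = G)
    (hGt : ∀ᶠ lam in 𝓝 (0 : Fin R → ℝ), IsDressed (tiltedGF E t lam) (selfEnergy S t) (Gt lam))
    (α : Fin R) (z w : Contour t) :
    heatKernel Gt α z w = heatKernel (tiltedGF E t) α z w +
      contourIntegral fun x => contourIntegral fun y =>
        (G z x * selfEnergy S t x y * heatKernel (tiltedGF E t) α y w +
          heatKernel Gt α z x * selfEnergy S t x y * bareGF E t y w) := by
  have hg := isRegular_heatKernel_dressed hE hS hG hG_unique hGt α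
  have hSig := isBddMeas_selfEnergy (t := t) hS
  have hc := isFredholmKernel_heatKernel_tiltedGF (t := t) hE α
  have hC := isFredholmKernel_bareGF (t := t) hE
  have h1 : ∀ x, (contourIntegral fun y =>
      (G z x * selfEnergy S t x y * heatKernel (tiltedGF E t) α y w +
        heatKernel Gt α z x * selfEnergy S t x y * bareGF E t y w)) = _ := fun x =>
    contourIntegral_add (fun b => integrable_matrix_mul hSig hc.isBddMeas (G z x) x w b)
      fun b => integrable_matrix_mul hSig hC.isBddMeas (heatKernel Gt α z x) x w b
  simp only [h1]
  rw [contourIntegral_add (integrable_contourIntegral hSig hc hG.1 z w)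
    (integrable_contourIntegral hSig hC hg z w), ← add_assoc]
  exact heatKernel_dressed_eq hE hS hG hG_unique hGt α z w

/-- Effective conjugation with exchange of the branches maps the tilted solution at `λ` to the one at
`-λ`, by uniqueness. The sign of the derivative is compensated by the conjugate of the factor `i`. -/
theorem heatKernel_dressed_star
    (hE : ∀ μ ν, ContDiff ℝ 1 fun p : ℝ × ℝ => E.correlation μ ν p.1 p.2)
    (hS : ∀ μ ν, Continuous fun s : ℝ => S.commutator μ ν s 0)
    (hG : IsDressed (bareGF E t) (selfEnergy S t) G)
    (hG_unique : ∀ G', IsDressed (bareGF E t) (selfEnergy S t) G' → G' = G)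
    (hGt : ∀ᶠ lam in 𝓝 (0 : Fin R → ℝ), IsDressed (tiltedGF E t lam) (selfEnergy S t) (Gt lam))
    (α : Fin R) :
    heatKernel Gt α = (heatKernel Gt α).star ζ := by
  have hsymm : ∀ᶠ lam in 𝓝 (0 : Fin R → ℝ), Gt lam = (Gt (-lam)).star ζ := by
    have hneg : Tendsto (fun lam : Fin R → ℝ => -lam) (𝓝 0) (𝓝 0) := by
      simpa using (continuous_neg (G := Fin R → ℝ)).tendsto 0
    filter_upwards [hGt, hneg.eventually hGt,
      eventually_existsUnique hE hS hG hG_unique] with lam h1 h2 h3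
    refine h3.unique h1 ?_
    have := h2.star ζ
    rwa [star_tiltedGF, star_selfEnergy, neg_neg] at this
  have hsingle : Tendsto (fun x : ℝ => (Pi.single α x : Fin R → ℝ)) (𝓝 0) (𝓝 0) := by
    have := (continuous_single (A := fun _ : Fin R => ℝ) α).tendsto 0
    rwa [Pi.single_zero] at this
  apply Kernel.scalar_injective
  funext y w
  let y' : IndexedContour R t := ((y.1.1.flip, y.1.2.bar), y.2)
  let w' : IndexedContour R t := ((w.1.1.flip, w.1.2.bar), w.2)
  obtain ⟨k, hk, -⟩ := exists_hasDerivAt_dressed hE hS hG hG_unique hGt α y'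
  have hφ := hk w'
  have h1 : HasDerivAt (fun x : ℝ => (Gt (Pi.single α (-x))).scalar y' w') (-k w') 0 := by
    have h := HasDerivAt.scomp (0 : ℝ) (by rwa [neg_zero]) (hasDerivAt_neg (0 : ℝ))
    rw [neg_one_smul] at h
    exact h
  have h2 : HasDerivAt (fun x : ℝ => (Gt (Pi.single α x)).scalar y w)
      (ζ.sign * conj (-k w')) 0 := by
    refine (h1.star.const_mul ζ.sign).congr_of_eventuallyEq ?_
    filter_upwards [hsingle.eventually hsymm] with x hx
    rw [hx, ← Pi.single_neg]
    exact effConj_apply _ _ _ _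
  rw [heatKernel_scalar h2]
  have h3 : ((heatKernel Gt α).star ζ).scalar y w =
      ζ.sign * conj ((heatKernel Gt α).scalar y' w') := effConj_apply _ _ _ _
  rw [h3, heatKernel_scalar hφ]
  simp
  ring

/-- The two ends of the contour, `t_+` and `t_-`, are related by cyclicity: at first argument `t`
the branch of the dressed Green's function does not matter, unless the second argument is `t` too.
The difference of the two rows agrees almost everywhere with a solution of the homogeneous
equation, which vanishes by uniqueness. -/
theorem dressed_endpoint
    (hE : ∀ μ ν, ContDiff ℝ 1 fun p : ℝ × ℝ => E.correlation μ ν p.1 p.2)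
    (hS : ∀ μ ν, Continuous fun s : ℝ => S.commutator μ ν s 0)
    (hG : IsDressed (bareGF E t) (selfEnergy S t) G)
    (hG_unique : ∀ G', IsDressed (bareGF E t) (selfEnergy S t) G' → G' = G)
    (ht : 0 ≤ t) (b : Branch) {u : Set.Icc (0 : ℝ) t} (hu : u ≠ ⟨t, ht, le_rfl⟩) :
    G (.backward, ⟨t, ht, le_rfl⟩) (b, u) = G (.forward, ⟨t, ht, le_rfl⟩) (b, u) := by
  ext ρ ν
  set T : Set.Icc (0 : ℝ) t := ⟨t, ht, le_rfl⟩
  let D := dysonKernels hE hS t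
  let y₁ : IndexedContour R t := ((.backward, ρ), T)
  let y₂ : IndexedContour R t := ((.forward, ρ), T)
  have hP : IsFredholmKernel (contourMeasure R t) (composeKernel (contourMeasure R t) D.S D.K) :=
    D.isFredholmKernel_compose D.isFredholmKernel_K
  have hK : ∀ w : IndexedContour R t, w.2 ≠ T → D.K y₁ w = D.K y₂ w := by
    rintro ⟨⟨c, κ⟩, v⟩ hv
    have hlt : v < T := lt_of_le_of_ne v.2.2 hv
    refine (contourOrdered_eq _ _ _ _).trans (Eq.trans ?_ (contourOrdered_eq _ _ _ _).symm)
    cases c <;> simp [y₁, y₂, orderWeight, IndexedContour.point, contourStep_forward,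
      contourStep_backward, hlt, hlt.not_gt, hlt.ne, hlt.ne']
  have hrow : ∀ y w, G.scalar y w = D.K y w + applyKernel (contourMeasure R t)
      (composeKernel (contourMeasure R t) D.S D.K) (G.scalar y) w := fun y w => by
    simpa using (solvesRow_zero hE hS hG y).2 w
  have hb := G.isRegular_iff.1 hG.1
  let h : IndexedContour R t → ℂ := fun w => G.scalar y₁ w - G.scalar y₂ w
  have hh : IsBddMeas h := (hb y₁).sub (hb y₂)
  let k : C(IndexedContour R t, ℂ) := ⟨_, hP.continuous_applyKernel hh⟩
  -- `h = K y₁ - K y₂ + k`, and the first two terms cancel away from time `t`.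
  have hhk : ∀ w, w.2 ≠ T → h w = k w := by
    intro w hw
    have h1 : G.scalar y₁ = fun x => h x + G.scalar y₂ x := funext fun x => by simp [h]
    have h2 := hrow y₁ w
    nth_rw 2 [h1] at h2
    rw [applyKernel_add hP hh (hb y₂), hK w hw] at h2
    have h3 := hrow y₂ w
    change G.scalar y₁ w - G.scalar y₂ w = applyKernel _ _ h w
    linear_combination h2 - h3
  have hk : k = 0 := by
    refine eq_zero_of_op_eq hE hS hG hG_unique k (ContinuousMap.ext fun w => ?_)
    refine integral_congr_ae ?_
    filter_upwards [ae_time_ne T] with x hx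
    rw [hhk x hx]
  have h0 := hhk ((b, ν), u) hu
  rw [hk] at h0
  exact sub_eq_zero.1 h0

end HeatKernel

/-! ### The system of equations in physical time -/

section PhysicalTime

variable {ζ : Statistics} {R : ℕ} {𝔥 : Fin R → Type*}
  [∀ α, NormedAddCommGroup (𝔥 α)] [∀ α, InnerProductSpace ℂ (𝔥 α)]
  {𝔄 : Type*} [Ring 𝔄] [StarRing 𝔄] [Algebra ℂ 𝔄] [StarModule ℂ 𝔄]
  {𝔨 : Type*} [NormedAddCommGroup 𝔨] [InnerProductSpace ℂ 𝔨]
  {𝔖 : Type*} [Ring 𝔖] [StarRing 𝔖] [Algebra ℂ 𝔖] [StarModule ℂ 𝔖]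
  {E : Environment ζ R 𝔥 𝔄} {S : System ζ R 𝔨 𝔖} {t : ℝ} {G : Kernel R t}
  {Gt : (Fin R → ℝ) → Kernel R t}

/-- `contourIntegral_langreth` for the self-energy: the forward-forward and the backward-backward
parts contribute with opposite signs, and both contain the time-ordered self-energy. -/
theorem contourIntegral_selfEnergy (A B : Contour t → Matrix (Idx R) (Idx R) ℂ) :
    (contourIntegral fun x => contourIntegral fun y => A x * selfEnergy S t x y * B y) =
      (timeIntegral fun u => timeIntegral fun v =>
        A (.forward, u) * (selfEnergy S t).timeOrd u v * B (.forward, v)) -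
      timeIntegral fun u => timeIntegral fun v =>
        A (.backward, u) * (selfEnergy S t).timeOrd u v * B (.backward, v) := by
  refine contourIntegral_langreth (fun u v => ⟨?_, ?_⟩) (fun u v => ?_) A B <;> ext μ ν
  · exact selfEnergy_apply _ _ _ _
  · exact selfEnergy_apply _ _ _ _
  · simp [selfEnergy_apply]

theorem timeIntegral_timeIntegral_zero (A : Set.Icc (0 : ℝ) t → Matrix (Idx R) (Idx R) ℂ)
    (K : TimeKernel R t) {B : Set.Icc (0 : ℝ) t → Matrix (Idx R) (Idx R) ℂ} (hB : ∀ v, B v = 0) :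
    (timeIntegral fun u => timeIntegral fun v => A u * K u v * B v) = 0 := by
  ext μ ν
  simp [timeIntegral, hB]

variable [Nontrivial 𝔖]

theorem heatKernel_dressed_greater
    (hE : ∀ μ ν, ContDiff ℝ 1 fun p : ℝ × ℝ => E.correlation μ ν p.1 p.2)
    (hS : ∀ μ ν, Continuous fun s : ℝ => S.commutator μ ν s 0)
    (hG : IsDressed (bareGF E t) (selfEnergy S t) G)
    (hG_unique : ∀ G', IsDressed (bareGF E t) (selfEnergy S t) G' → G' = G)
    (hGt : ∀ᶠ lam in 𝓝 (0 : Fin R → ℝ), IsDressed (tiltedGF E t lam) (selfEnergy S t) (Gt lam))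
    (α : Fin R) (x y : Set.Icc (0 : ℝ) t) :
    (heatKernel Gt α).greater x y = (heatKernel (tiltedGF E t) α).greater x y
      - functionalK G.antiOrd (selfEnergy S t).timeOrd (heatKernel (tiltedGF E t) α).greater x y
      + functionalI (bareGF E t).timeOrd (selfEnergy S t).timeOrd (heatKernel Gt α).greater x y
      - functionalI (bareGF E t).greater (selfEnergy S t).timeOrd (heatKernel Gt α).antiOrd x y := by
  refine (heatKernel_dressed_eq hE hS hG hG_unique hGt α (.backward, x) (.forward, y)).trans ?_
  rw [contourIntegral_selfEnergy, contourIntegral_selfEnergy,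
    timeIntegral_timeIntegral_zero _ _ fun v => heatKernel_tiltedGF_same hE α .forward v y,
    zero_sub, ← sub_eq_add_neg, ← add_sub_assoc]
  rfl

theorem heatKernel_dressed_antiOrd
    (hE : ∀ μ ν, ContDiff ℝ 1 fun p : ℝ × ℝ => E.correlation μ ν p.1 p.2)
    (hS : ∀ μ ν, Continuous fun s : ℝ => S.commutator μ ν s 0)
    (hG : IsDressed (bareGF E t) (selfEnergy S t) G)
    (hG_unique : ∀ G', IsDressed (bareGF E t) (selfEnergy S t) G' → G' = G)
    (hGt : ∀ᶠ lam in 𝓝 (0 : Fin R → ℝ), IsDressed (tiltedGF E t lam) (selfEnergy S t) (Gt lam))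
    (α : Fin R) (x y : Set.Icc (0 : ℝ) t) :
    (heatKernel Gt α).antiOrd x y =
      functionalK G.greater (selfEnergy S t).timeOrd (heatKernel (tiltedGF E t) α).lesser x y
      + functionalI (bareGF E t).lesser (selfEnergy S t).timeOrd (heatKernel Gt α).greater x y
      - functionalI (bareGF E t).antiOrd (selfEnergy S t).timeOrd
        (heatKernel Gt α).antiOrd x y := by
  refine (heatKernel_dressed_eq hE hS hG hG_unique hGt α (.backward, x) (.backward, y)).trans ?_
  have h := timeIntegral_timeIntegral_zero (fun u => G (.backward, x) (.backward, u))
    (selfEnergy S t).timeOrd fun v => heatKernel_tiltedGF_same hE α .backward v y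
  rw [contourIntegral_selfEnergy, contourIntegral_selfEnergy, h,
    heatKernel_tiltedGF_same hE α .backward x y, zero_add, sub_zero, ← add_sub_assoc]
  rfl

/-- At the end of the contour the anti-time-ordered component of `G` agrees almost everywhere with
the lesser one. -/
theorem functionalK_endpoint
    (hE : ∀ μ ν, ContDiff ℝ 1 fun p : ℝ × ℝ => E.correlation μ ν p.1 p.2)
    (hS : ∀ μ ν, Continuous fun s : ℝ => S.commutator μ ν s 0)
    (hG : IsDressed (bareGF E t) (selfEnergy S t) G)
    (hG_unique : ∀ G', IsDressed (bareGF E t) (selfEnergy S t) G' → G' = G)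
    (ht : 0 ≤ t) (K f : TimeKernel R t) (y : Set.Icc (0 : ℝ) t) :
    functionalK G.antiOrd K f ⟨t, ht, le_rfl⟩ y = functionalK G.lesser K f ⟨t, ht, le_rfl⟩ y := by
  ext μ ν
  refine integral_congr_ae ?_
  have h : ∀ᵐ u ∂timeMeasure t, u ≠ ⟨t, ht, le_rfl⟩ := by simp [ae_iff, timeMeasure_singleton]
  filter_upwards [h] with u hu
  have h1 := dressed_endpoint hE hS hG hG_unique ht .backward hu
  simp only [Kernel.antiOrd, Kernel.lesser, h1]

end PhysicalTime

end Keldysh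

end

theorem mainTheorem3 {ζ : Statistics} {R : ℕ} {𝔥 : Fin R → Type*}
    [∀ α, NormedAddCommGroup (𝔥 α)] [∀ α, InnerProductSpace ℂ (𝔥 α)]
    {𝔄 : Type*} [Ring 𝔄] [StarRing 𝔄] [Algebra ℂ 𝔄] [StarModule ℂ 𝔄]
    {𝔨 : Type*} [NormedAddCommGroup 𝔨] [InnerProductSpace ℂ 𝔨]
    {𝔖 : Type*} [Ring 𝔖] [Nontrivial 𝔖] [StarRing 𝔖] [Algebra ℂ 𝔖] [StarModule ℂ 𝔖]
    (E : Environment ζ R 𝔥 𝔄) (S : System ζ R 𝔨 𝔖)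
    (hE : ∀ μ ν, ContDiff ℝ 1 fun p : ℝ × ℝ => E.correlation μ ν p.1 p.2)
    (hS : ∀ μ ν, Continuous fun s : ℝ => S.commutator μ ν s 0)
    (t : ℝ) (ht : 0 ≤ t)
    (G : Kernel R t) (hG : IsDressed (bareGF E t) (selfEnergy S t) G)
    (hG_unique : ∀ G', IsDressed (bareGF E t) (selfEnergy S t) G' → G' = G) :
    -- near `λ = 0` the tilted dressed Green's function exists and is unique
    (∀ᶠ lam in 𝓝 (0 : Fin R → ℝ), ∃! G', IsDressed (tiltedGF E t lam) (selfEnergy S t) G') ∧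
    ∀ Gt : (Fin R → ℝ) → Kernel R t,
      (∀ᶠ lam in 𝓝 (0 : Fin R → ℝ), IsDressed (tiltedGF E t lam) (selfEnergy S t) (Gt lam)) →
      ∀ (α : Fin R) (C Sig c g : Kernel R t),
        C = bareGF E t → Sig = selfEnergy S t →
        c = heatKernel (tiltedGF E t) α → g = heatKernel Gt α →
        -- the derivatives that define the bare and the dressed heat kernel exist
        (∀ z w μ ν,
          DifferentiableAt ℝ (fun x : ℝ => tiltedGF E t (Pi.single α x) z w μ ν) 0 ∧
          DifferentiableAt ℝ (fun x : ℝ => Gt (Pi.single α x) z w μ ν) 0) ∧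
        c.IsRegular ∧ g.IsRegular ∧
        -- the Dyson-type equation on the contour
        (∀ z w, g z w = c z w + contourIntegral fun x => contourIntegral fun y =>
          (G z x * Sig x y * c y w + g z x * Sig x y * C y w)) ∧
        -- the closed system in physical time, for every first argument
        (∀ x y,
          g.greater x y = c.greater x y - functionalK G.antiOrd Sig.timeOrd c.greater x y
            + functionalI C.timeOrd Sig.timeOrd g.greater x y
            - functionalI C.greater Sig.timeOrd g.antiOrd x y ∧
          g.antiOrd x y = functionalK G.greater Sig.timeOrd c.lesser x y
            + functionalI C.lesser Sig.timeOrd g.greater x y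
            - functionalI C.antiOrd Sig.timeOrd g.antiOrd x y) ∧
        -- at first argument `t`, the functional `K^<` takes the place of the anti-time-ordered one
        (∀ y,
          g.greater ⟨t, ht, le_rfl⟩ y = c.greater ⟨t, ht, le_rfl⟩ y
            - functionalK G.lesser Sig.timeOrd c.greater ⟨t, ht, le_rfl⟩ y
            + functionalI C.timeOrd Sig.timeOrd g.greater ⟨t, ht, le_rfl⟩ y
            - functionalI C.greater Sig.timeOrd g.antiOrd ⟨t, ht, le_rfl⟩ y) ∧
        -- the remaining two components, by effective conjugation
        ∀ x y, g.lesser x y = effConj ζ (g.greater x y) ∧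
          g.timeOrd x y = effConj ζ (g.antiOrd x y) := by
  refine ⟨eventually_existsUnique hE hS hG hG_unique, ?_⟩
  rintro Gt hGt α _ _ _ _ rfl rfl rfl rfl
  refine ⟨fun z w μ ν => ⟨?_, ?_⟩, isRegular_heatKernel_tiltedGF hE α,
    isRegular_heatKernel_dressed hE hS hG hG_unique hGt α,
    heatKernel_dressed_eq_contourIntegral hE hS hG hG_unique hGt α,
    fun x y => ⟨heatKernel_dressed_greater hE hS hG hG_unique hGt α x y,
      heatKernel_dressed_antiOrd hE hS hG hG_unique hGt α x y⟩, fun y => ?_, fun x y => ?_⟩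
  · exact (hasDerivAt_tiltedGF hE α ((z.1, μ), z.2) ((w.1, ν), w.2)).differentiableAt
  · obtain ⟨k, hk, -⟩ := exists_hasDerivAt_dressed hE hS hG hG_unique hGt α ((z.1, μ), z.2)
    exact (hk ((w.1, ν), w.2)).differentiableAt
  · rw [← functionalK_endpoint hE hS hG hG_unique ht]
    exact heatKernel_dressed_greater hE hS hG hG_unique hGt α _ y
  · have h := heatKernel_dressed_star hE hS hG hG_unique hGt α
    exact ⟨congrFun (congrFun h (.forward, x)) (.backward, y),
      congrFun (congrFun h (.forward, x)) (.forward, y)⟩
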